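/- **Systems.** Consider linear systems $\frac{dY}{dx}=A(x)Y$ with $A(x)$ an $m\times m$ matrix of rational functions, $m\ge 1$. A system is irreducible if no proper non-zero subspace of $\mathbb C^m$ is invariant under all values of $A(x)$ outside its poles. At a point of $\mathbb P^1$ with local coordinate $z$ ($z=x-u$ or $z=1/x$), write the system as $\frac{dY}{dz}=B(z)Y$ with $B\in M(m,\mathbb C(\!(z)\!))$; the point is singular if $B$ has a pole. It is an unramified singular point of Poincaré rank $b\ge 0$ if, for some $G\in \mathrm{GL}(m,\mathbb C[[z]])$, $$GBG^{-1}+\tfrac{dG}{dz}G^{-1}=\frac{T_0}{z^{b+1}}+\cdots+\frac{T_{b-1}}{z^{2}}+\frac{\Theta}{z}$$ with all $T_j$ and $\Theta$ diagonal, leading coefficient non-zero ($T_0\neq0$, or $\Theta\ne0$ if $b=0$), and no two eigenvalues of $\Theta$ differing by a non-zero integer. Its spectral type is the refining sequence of partitions of $m$ obtained by splitting $\{1,\dots,m\}$ according to the diagonal entries of $T_0$, each part according to $T_1$, and so on up to $\Theta$. For $b=0$ it is the partition of $m$ given by the multiplicities of the eigenvalues of $\Theta$. For $b=1$ it is written $(\mu_1)\cdots(\mu_k)$,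 where the $\mu_j$ are partitions of the multiplicities $m_j=|\mu_j|$ of the eigenvalues of $T_0$. The spectral type of a system is the collection of the spectral types of its singular points. For a Fuchsian type, a tuple of $N$ partitions of $m$ with parts $m_{\nu j}$, the number of accessory parameters is $2+(N-2)m^2-\sum_{\nu,j}m_{\nu j}^2$. **Equivalence.** A spectral type $S_1$ is equivalent to $S_2$ if an irreducible system of type $S_2$ is obtained from an irreducible system of type $S_1$ by finitely many applications of: - Möbius transformations of $x$; - additions $A(x)\mapsto A(x)+f(x)I$ with $f$ a rational function; - the Laplace transform, taking $\frac{dY}{dx}=(Q(x-T)^{-1}P+S)Y$, with $T$ of minimal size for the matrix $Q(x-T)^{-1}P$, to $\frac{dY}{dx}=(-P(x-S)^{-1}Q-T)Y$. Let $[S]$ denote the class of $S$. **Confluence.** An irreducible system $E_0$ is obtained by confluence of two regular singular points from irreducible systems $E_\varepsilon$ ($\varepsilon\to 0^+$) of constant spectral type if: - two regular singular points of $E_\varepsilon$, with partitions $(|\mu_1|,\dots,|\mu_k|)$ and its refinement $\mu_1\cup\cdots\cup\mu_k$, tend to one point, which is a singular point of $E_0$ of type $(\mu_1)\cdots(\mu_k)$;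 - the other singular points of $E_\varepsilon$ tend to the other singular points of $E_0$, which are distinct, keeping their spectral types; - the coefficient matrix of $E_\varepsilon$ tends to that of $E_0$ at every point $x\in\mathbb C$ that is not a singular point of $E_0$. Write $[S_1]\to[S_2]$ if such a confluence exists with the type of $E_\varepsilon$ equivalent to $S_1$ and the type of $E_0$ equivalent to $S_2$. **Theorem.** The nine spectral types with three singular points $$211,1111,1111;\quad 221,221,11111;\quad 32,11111,11111;\quad 222,222,2211;\quad 33,2211,111111;$$ $$44,2222,22211;\quad 44,332,11111111;\quad 55,3331,22222;\quad 66,444,2222211$$ and the types $11,11,11,11,11$; $21,21,111,111$; $31,22,22,1111$; $22,22,22,211$ all have four accessory parameters, and their classes admit the following degeneration scheme (in which $[55,3331,22222]$ is an isolated vertex): - $[44,332,11111111]\to[32,11111,11111]\to[211,1111,1111]$; - $[33,2211,111111]\to[211,1111,1111]$ and $[33,2211,111111]\to[221,221,11111]$; - $[211,1111,1111]\to[11,11,11,11,11]$ and $[211,1111,1111]\to[21,21,111,111]$; - $[221,221,11111]\to[21,21,111,111]$ and $[221,221,11111]\to[31,22,22,1111]$; - $[66,444,2222211]\to[44,2222,22211]\to[222,222,2211]\to[22,22,22,211]$.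 "Isolated" means only that the scheme displays no arrow at that vertex; the theorem does not assert that no further arrows exist. -/

import Mathlib

open Filter Topology

noncomputable section

namespace DegScheme

/-! ### Linear systems with rational coefficients -/

/-- A linear system `dY/dx = A(x) Y`, where `A(x)` is a square matrix of rational functions.
By partial fractions these are exactly the systems
`dY/dx = (∑_ν ∑_k A_ν^{(k)} (x - u_ν)^{-k-1} + ∑_k A_∞^{(k)} x^{k-1}) Y`. -/
structure LinSystem where
  /-- the size `m` of the system -/
  rank : ℕ
  /-- the coefficient matrix `A(x)` -/
  coeff : Matrix (Fin rank) (Fin rank) (RatFunc ℂ)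

/-- The value of `A(x)` at a complex number `x` (meaningful where `A` has no pole). -/
def evalAt {m : ℕ} (A : Matrix (Fin m) (Fin m) (RatFunc ℂ)) (x : ℂ) :
    Matrix (Fin m) (Fin m) ℂ :=
  A.map fun f => f.eval (RingHom.id ℂ) x

/-- The system is irreducible: it has positive size and no proper non-zero subspace of `ℂ^m` is
invariant under all the values of `A(x)` outside the poles (equivalently, under all the
coefficient matrices `A_ν^{(k)}`). -/
def LinSystem.Irreducible (E : LinSystem) : Prop :=
  0 < E.rank ∧ ∀ V : Submodule ℂ (Fin E.rank → ℂ),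
    (∀ x : ℂ, (∀ i j, (E.coeff i j).denom.eval x ≠ 0) →
      ∀ v ∈ V, (evalAt E.coeff x).mulVec v ∈ V) → V = ⊥ ∨ V = ⊤

/-! ### Local forms at the points of the Riemann sphere -/

/-- The coefficient matrix of the system in the local coordinate `z` at a point of the Riemann
sphere, as a matrix of formal Laurent series: `z = x - u` at a finite point `u`, where it is
`A(u + z)`, and `z = 1/x` at infinity, where it is `-z⁻² A(1/z)`. -/
def localCoeff {m : ℕ} (A : Matrix (Fin m) (Fin m) (RatFunc ℂ)) :
    OnePoint ℂ → Matrix (Fin m) (Fin m) (LaurentSeries ℂ)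
  | some u => A.map fun f =>
      f.eval (HahnSeries.C : ℂ →+* LaurentSeries ℂ) (HahnSeries.C u + HahnSeries.single 1 1)
  | none => A.map fun f =>
      -HahnSeries.single (-2) 1 *
        f.eval (HahnSeries.C : ℂ →+* LaurentSeries ℂ) (HahnSeries.single (-1) 1)

/-- The point `p` is not a singular point: the local coefficient matrix is a power series. -/
def IsNonsingularAt {m : ℕ} (A : Matrix (Fin m) (Fin m) (RatFunc ℂ)) (p : OnePoint ℂ) : Prop :=
  ∃ B : Matrix (Fin m) (Fin m) (PowerSeries ℂ),
    localCoeff A p = B.map (HahnSeries.ofPowerSeries ℤ ℂ)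

/-- The diagonal unramified form
`T_0 z^{-(b+1)} + T_1 z^{-b} + ⋯ + T_{b-1} z^{-2} + Θ z^{-1}`, where
`T_j = diag (t j)` for `j < b` and `Θ = diag (t b)`. -/
def htlForm {m b : ℕ} (t : Fin (b + 1) → Fin m → ℂ) :
    Matrix (Fin m) (Fin m) (LaurentSeries ℂ) :=
  Matrix.diagonal fun i => ∑ j : Fin (b + 1), HahnSeries.single ((j : ℤ) - (b + 1)) (t j i)

/-- `H` is obtained from `B` by the gauge transformation
`B ↦ G B G⁻¹ + (dG/dz) G⁻¹` with `G` an invertible matrix of formal power series. -/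
def IsFormalGauge {m : ℕ} (G : GL (Fin m) (PowerSeries ℂ))
    (B H : Matrix (Fin m) (Fin m) (LaurentSeries ℂ)) : Prop :=
  (G.val.map (HahnSeries.ofPowerSeries ℤ ℂ)) * B +
      G.val.map (fun f => HahnSeries.ofPowerSeries ℤ ℂ (PowerSeries.derivative ℂ f)) =
    H * G.val.map (HahnSeries.ofPowerSeries ℤ ℂ)

/-! ### Spectral types -/

/-- Nested partitions of depth `b`: a number for `b = 0`, a partition for `b = 1`, a
partition each of whose parts is again partitioned, such as `(111)(11)`, for `b = 2`, etc. -/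
def Nested : ℕ → Type
  | 0 => ℕ
  | b + 1 => Multiset (Nested b)

/-- The refining sequence of partitions of the index set `s` cut out by the columns
`t 0, t 1, …`: split `s` by the values of `t 0`, each part by the values of `t 1`, and so on;
at the end record the sizes of the parts. -/
def nestedOf {m : ℕ} : (b : ℕ) → (Fin b → Fin m → ℂ) → Finset (Fin m) → Nested b
  | 0, _, s => s.card
  | b + 1, t, s =>
      (open Classical in (s.image (t 0)).val.map fun c =>
        nestedOf b (fun j => t j.succ) (s.filter fun i => t 0 i = c) : Multiset (Nested b))

/-- The spectral type of a singular point: its Poincaré rank `b`, with a nested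
partition of depth `b + 1`. -/
abbrev LocalType : Type := Σ b : ℕ, Nested (b + 1)

/-- The spectral type of a system: the types of its singular points, in any order. -/
abbrev SpectralType : Type := Multiset LocalType

/-- The spectral type of a regular singular point, given by a partition. -/
def regularType (l : Multiset ℕ) : LocalType := ⟨0, l⟩

/-- The spectral type `(μ₁)(μ₂)⋯(μ_k)` of a singular point of Poincaré rank one. -/
def rankOneType (μ : Multiset (Multiset ℕ)) : LocalType := ⟨1, μ⟩

/-- The spectral type of a Fuchsian system, given by a tuple of partitions. -/
def fuchsianType (L : List (List ℕ)) : SpectralType :=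
  ((L.map fun l => regularType (l : Multiset ℕ) : List LocalType) : Multiset LocalType)

/-- `p` is a singular point of the system with spectral type `τ`: a formal gauge transformation
brings the system at `p` to an unramified form with diagonal residue matrix `Θ`, non-zero
leading coefficient, and no two eigenvalues of `Θ` differing by a non-zero integer; and `τ` is
the refining sequence of partitions given by its exponents. -/
def HasLocalType {m : ℕ} (A : Matrix (Fin m) (Fin m) (RatFunc ℂ)) (p : OnePoint ℂ)
    (τ : LocalType) : Prop :=
  ∃ (t : Fin (τ.1 + 1) → Fin m → ℂ) (G : GL (Fin m) (PowerSeries ℂ)),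
    t 0 ≠ 0 ∧
    (∀ (i j : Fin m) (n : ℤ), t (Fin.last τ.1) i - t (Fin.last τ.1) j = (n : ℂ) → n = 0) ∧
    IsFormalGauge G (localCoeff A p) (htlForm t) ∧
    nestedOf (τ.1 + 1) t Finset.univ = τ.2

/-- The singular points of the system are exactly the distinct points `s 0, …, s (k-1)`, and
their spectral types are `τ 0, …, τ (k-1)`. -/
def HasTypesAt {m k : ℕ} (A : Matrix (Fin m) (Fin m) (RatFunc ℂ)) (s : Fin k → OnePoint ℂ)
    (τ : Fin k → LocalType) : Prop :=
  Function.Injective s ∧ (∀ i, HasLocalType A (s i) (τ i)) ∧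
    ∀ p, p ∉ Set.range s → IsNonsingularAt A p

/-- The collection of the local types `τ 0, …, τ (k-1)`. -/
def typeOf {k : ℕ} (τ : Fin k → LocalType) : SpectralType := Finset.univ.val.map τ

/-- `E` is an irreducible system of spectral type `S`. -/
def Realizes (E : LinSystem) (S : SpectralType) : Prop :=
  E.Irreducible ∧ ∃ (k : ℕ) (s : Fin k → OnePoint ℂ) (τ : Fin k → LocalType),
    HasTypesAt E.coeff s τ ∧ S = typeOf τ

/-- The number of accessory parameters `2 + (N - 2) m² - ∑_ν ∑_j m_{νj}²` of a Fuchsian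
spectral type of size `m` with `N` singular points. -/
def accessoryParameters (m : ℕ) (L : List (List ℕ)) : ℤ :=
  2 + ((L.length : ℤ) - 2) * (m : ℤ) ^ 2 -
    (L.map fun l => (l.map fun a => (a : ℤ) ^ 2).sum).sum

/-- A tuple of partitions of one number `m`, with four accessory parameters. -/
def HasFourAccessoryParameters (L : List (List ℕ)) : Prop :=
  ∃ m : ℕ, (∀ l ∈ L, l.sum = m ∧ ∀ a ∈ l, 0 < a) ∧ accessoryParameters m L = 4

/-! ### Operations on systems and equivalence of spectral types -/

/-- The system satisfied by `Y((a w + b)/(c w + d))`: its coefficient matrix is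
`(ad - bc)/(c w + d)² · A((a w + b)/(c w + d))`. -/
def mobius {m : ℕ} (a b c d : ℂ) (A : Matrix (Fin m) (Fin m) (RatFunc ℂ)) :
    Matrix (Fin m) (Fin m) (RatFunc ℂ) :=
  A.map fun f =>
    RatFunc.C (a * d - b * c) / (RatFunc.C c * RatFunc.X + RatFunc.C d) ^ 2 *
      f.eval (RatFunc.C : ℂ →+* RatFunc ℂ)
        ((RatFunc.C a * RatFunc.X + RatFunc.C b) / (RatFunc.C c * RatFunc.X + RatFunc.C d))

/-- The rational matrix `Q (x - T)⁻¹ P`. -/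
def transferMatrix {m n : ℕ} (Q : Matrix (Fin m) (Fin n) ℂ) (T : Matrix (Fin n) (Fin n) ℂ)
    (P : Matrix (Fin n) (Fin m) ℂ) : Matrix (Fin m) (Fin m) (RatFunc ℂ) :=
  Q.map RatFunc.C * (Matrix.scalar (Fin n) RatFunc.X - T.map RatFunc.C)⁻¹ * P.map RatFunc.C

/-- The size `n` of `T` is minimal among the expressions of the same rational matrix
in the form `Q (x - T)⁻¹ P`. -/
def IsMinimal {m n : ℕ} (Q : Matrix (Fin m) (Fin n) ℂ) (T : Matrix (Fin n) (Fin n) ℂ)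
    (P : Matrix (Fin n) (Fin m) ℂ) : Prop :=
  ∀ (n' : ℕ) (Q' : Matrix (Fin m) (Fin n') ℂ) (T' : Matrix (Fin n') (Fin n') ℂ)
    (P' : Matrix (Fin n') (Fin m) ℂ),
    transferMatrix Q' T' P' = transferMatrix Q T P → n ≤ n'

/-- One application of a Möbius transformation, of an addition, or of the Laplace transform. -/
inductive Step : LinSystem → LinSystem → Prop
  | mobius (E : LinSystem) (a b c d : ℂ) (h : a * d - b * c ≠ 0) :
      Step E ⟨E.rank, mobius a b c d E.coeff⟩
  /-- Adding the scalar matrix `f(x) I`; by partial fractions, a finite succession of shifts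
  `A_ν^{(k)} ↦ A_ν^{(k)} + α I` of coefficient matrices. -/
  | addition (E : LinSystem) (f : RatFunc ℂ) :
      Step E ⟨E.rank, E.coeff + Matrix.scalar (Fin E.rank) f⟩
  /-- From `dY/dx = (Q (x - T)⁻¹ P + S) Y` to `dY/dx = (-P (x - S)⁻¹ Q - T) Y`. -/
  | laplace (m n : ℕ) (Q : Matrix (Fin m) (Fin n) ℂ) (T : Matrix (Fin n) (Fin n) ℂ)
      (P : Matrix (Fin n) (Fin m) ℂ) (S : Matrix (Fin m) (Fin m) ℂ) (h : IsMinimal Q T P) :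
      Step ⟨m, transferMatrix Q T P + S.map RatFunc.C⟩
        ⟨n, -transferMatrix P S Q - T.map RatFunc.C⟩

/-- `S₁` is equivalent to `S₂`: an irreducible system of spectral type `S₂` is obtained from one
of spectral type `S₁` by finitely many Möbius transformations, additions and
Laplace transforms. -/
def Equivalent (S₁ S₂ : SpectralType) : Prop :=
  ∃ E₁ E₂ : LinSystem, Realizes E₁ S₁ ∧ Realizes E₂ S₂ ∧ Relation.ReflTransGen Step E₁ E₂

/-! ### Confluence of singular points -/

/-- The irreducible system `A₀`, of spectral type `S₂`, is obtained by confluence of two regular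
singular points from the irreducible systems `A ε`, of spectral type `S₁`, as `ε → 0`.
Two regular singular points `a ε`, `b ε` of `A ε` tend to the same point `c`, the remaining
ones `p i ε` tend to distinct points `q i` other than `c`, and `A ε` tends to `A₀`. The
partitions at `a ε`, `b ε` are `λ = (|μ₁|, …, |μ_k|)` and its refinement `μ₁ ∪ ⋯ ∪ μ_k`; the
type of `A₀` at `c` is `(μ₁)⋯(μ_k)`, and the types of all the other points are unchanged. -/
def IsConfluence {m : ℕ} (A : ℝ → Matrix (Fin m) (Fin m) (RatFunc ℂ))
    (A₀ : Matrix (Fin m) (Fin m) (RatFunc ℂ)) (S₁ S₂ : SpectralType) : Prop :=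
  ∃ (k : ℕ) (μ : Multiset (Multiset ℕ)) (τ : Fin k → LocalType)
    (a b : ℝ → OnePoint ℂ) (p : Fin k → ℝ → OnePoint ℂ)
    (c : OnePoint ℂ) (q : Fin k → OnePoint ℂ),
    S₁ = regularType (μ.map Multiset.sum) ::ₘ regularType μ.sum ::ₘ typeOf τ ∧
    S₂ = rankOneType μ ::ₘ typeOf τ ∧
    (∀ᶠ ε in 𝓝[>] (0 : ℝ), LinSystem.Irreducible ⟨m, A ε⟩ ∧
      HasTypesAt (A ε) (Fin.cons (a ε) (Fin.cons (b ε) fun i => p i ε))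
        (Fin.cons (regularType (μ.map Multiset.sum)) (Fin.cons (regularType μ.sum) τ))) ∧
    LinSystem.Irreducible ⟨m, A₀⟩ ∧
    HasTypesAt A₀ (Fin.cons c q) (Fin.cons (rankOneType μ) τ) ∧
    Tendsto a (𝓝[>] 0) (𝓝 c) ∧ Tendsto b (𝓝[>] 0) (𝓝 c) ∧
    (∀ i, Tendsto (p i) (𝓝[>] 0) (𝓝 (q i))) ∧
    ∀ x : ℂ, (x : OnePoint ℂ) ≠ c → (∀ i, (x : OnePoint ℂ) ≠ q i) →
      Tendsto (fun ε => evalAt (A ε) x) (𝓝[>] 0) (𝓝 (evalAt A₀ x))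

/-- The arrow `[S₁] → [S₂]`: a system whose spectral type is equivalent to `S₂` is obtained from
systems whose spectral type is equivalent to `S₁` by a confluence of singular points. -/
def Arrow (S₁ S₂ : SpectralType) : Prop :=
  ∃ S₁' S₂' : SpectralType, Equivalent S₁ S₁' ∧ Equivalent S₂' S₂ ∧
    ∃ (m : ℕ) (A : ℝ → Matrix (Fin m) (Fin m) (RatFunc ℂ))
      (A₀ : Matrix (Fin m) (Fin m) (RatFunc ℂ)), IsConfluence A A₀ S₁' S₂'

end DegScheme

end

/-!
Every arrow comes from one construction. Let `P` be an `r × m` and `Q` an `m × r` matrix, cut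
`{1, …, m}` into blocks `β = k`, put `Θ = Q P / N` and `S = diag (i β)`, and suppose that `P Q` and
the diagonal blocks of `Q P` are diagonal with non-zero entries, small in comparison with `N`.

* `dY/dx = (Θ / x + S) Y` has a regular singular point at `0`, with the eigenvalues of `P Q / N` and
  `0`, and a point of Poincaré rank one at `∞`, where `S` separates the blocks and the diagonal
  blocks of `Θ` are the residue: formally, `Θ / x + S` can be made block diagonal
  (`hasLocalType_infty_pfrac`).
* With `L` the part of `Θ` strictly below the blocks, the Fuchsian systems with coefficient
  `A_ε = Θ / x - (S / ε + L) / (x - 1 / ε)` tend to it as `ε → 0`, and the points `1 / ε` and `∞`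
  tend to `∞`. The residue `-(S / ε + L)` is block triangular with scalar diagonal blocks and
  distinct eigenvalues on distinct blocks, and the residue at `∞` comes from the block triangular
  matrix `Θ - L - S / ε`. So both are diagonalizable, and their spectral types are the partition
  by `β` and its refinement by the diagonal of `Q P` (`diagonalizableTo_of_blockTriangular`).
* The Laplace transform of the limit is `dY/dx = -∑ P_k Q_k / (N (x - i k)) Y`, where `P_k` and
  `Q_k` belong to the block `k`. It is Fuchsian, with diagonalizable residues because `Q_k P_k` and
  `P Q` are diagonal (`diagonalizableTo_of_mul`).

At a simple pole with diagonalizable residue, no two of whose eigenvalues differ by a non-zero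
integer, the system is formally equivalent to its leading term; the gauge transformation solves a
recursion (`HasSimplePole.hasLocalType`). The bound on the eigenvalues by `N` excludes differences
`± 1, ± 2, …` between real parts, and the factor `i` in `S` those between eigenvalues on
distinct blocks.

A subspace invariant under the values of `Θ / x + S` is invariant under the algebra generated by `Θ`
and `S`. This algebra contains the projections on the blocks, hence the block diagonal part of `Θ`,
hence the projections on the joint level sets of `β` and of the diagonal of `Q P`. If one of these
level sets is a single index `i₀`, and if every basis vector is reached from `e_{i₀}` by alternately
applying `Θ` and projecting, for `Θ` as for its transpose, then it is the full matrix algebra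
(`eq_top_of_reaches`), so the limit is irreducible. Generating the full algebra is an open
condition, so `A_ε` is irreducible for small `ε` (`eventually_adjoin_eq_top`). A subspace
invariant under the Laplace transform gives one invariant under `Θ` and `S`, and is trivial too.

`Datum.arrow` puts this together, and each of the eleven arrows then needs an integral solution
`P`, `Q` with prescribed multiplicities.
-/

namespace DegScheme

/-! ### Expansion of rational functions at the points of the Riemann sphere -/

/-- Power series in the local coordinate, inside the Laurent series. -/
noncomputable abbrev ofPS : PowerSeries ℂ →+* LaurentSeries ℂ := HahnSeries.ofPowerSeries ℤ ℂ

/-- The local coordinate `z` as a Laurent series. -/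
noncomputable abbrev lz : LaurentSeries ℂ := HahnSeries.single 1 1

/-- The inverse `z⁻¹` of the local coordinate. -/
noncomputable abbrev lzInv : LaurentSeries ℂ := HahnSeries.single (-1) 1

lemma lzInv_mul_lz : lzInv * lz = 1 := by
  simp [lzInv, lz, HahnSeries.single_mul_single]

lemma lz_ne_zero : lz ≠ 0 := by
  intro h
  have := lzInv_mul_lz
  rw [h, mul_zero] at this
  exact zero_ne_one this

lemma lzInv_eq : lzInv = lz⁻¹ := eq_inv_of_mul_eq_one_left lzInv_mul_lz

lemma ofPS_injective : Function.Injective ofPS := HahnSeries.ofPowerSeries_injective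

/-- Evaluation of rational functions at a Laurent series which is transcendental over `ℂ`. -/
noncomputable def evalHom (a : LaurentSeries ℂ)
    (ha : ∀ p : Polynomial ℂ, p ≠ 0 → p.eval₂ (HahnSeries.C : ℂ →+* LaurentSeries ℂ) a ≠ 0) :
    RatFunc ℂ →+* LaurentSeries ℂ where
  toFun f := f.eval HahnSeries.C a
  map_one' := RatFunc.eval_one _ _
  map_zero' := RatFunc.eval_zero _ _
  map_add' f g := RatFunc.eval_add _ _ (ha _ f.denom_ne_zero) (ha _ g.denom_ne_zero)
  map_mul' f g := RatFunc.eval_mul _ _ (ha _ f.denom_ne_zero) (ha _ g.denom_ne_zero)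

lemma eval₂_shift_ne_zero (u : ℂ) (p : Polynomial ℂ) (hp : p ≠ 0) :
    p.eval₂ (HahnSeries.C : ℂ →+* LaurentSeries ℂ) (HahnSeries.C u + lz) ≠ 0 := by
  have h1 : (HahnSeries.C : ℂ →+* LaurentSeries ℂ) =
      ofPS.comp ((Polynomial.coeToPowerSeries.ringHom (R := ℂ)).comp Polynomial.C) := by
    ext1 c
    simp [HahnSeries.ofPowerSeries_C]
  have h2 : (HahnSeries.C u + lz : LaurentSeries ℂ) =
      ofPS (Polynomial.coeToPowerSeries.ringHom (Polynomial.X + Polynomial.C u)) := by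
    simp [HahnSeries.ofPowerSeries_C, HahnSeries.ofPowerSeries_X, add_comm]
  rw [h2, h1, ← RingHom.comp_assoc, ← RingHom.comp_apply, ← Polynomial.hom_eval₂]
  change (ofPS.comp Polynomial.coeToPowerSeries.ringHom) (p.comp _) ≠ 0
  have h3 : p.comp (Polynomial.X + Polynomial.C u) ≠ 0 := by
    intro h
    apply hp
    have := congrArg (fun q : Polynomial ℂ => q.comp (Polynomial.X - Polynomial.C u)) h
    simpa [Polynomial.comp_assoc] using this
  intro h
  apply h3
  rw [RingHom.comp_apply] at h
  have h4 := ofPS_injective (h.trans (map_zero ofPS).symm)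
  exact Polynomial.coe_injective ℂ (by simpa using h4)

lemma eval₂_lzInv_ne_zero (p : Polynomial ℂ) (hp : p ≠ 0) :
    p.eval₂ (HahnSeries.C : ℂ →+* LaurentSeries ℂ) lzInv ≠ 0 := by
  have hlz := eval₂_shift_ne_zero 0 p.reverse (by simpa using hp)
  rw [map_zero, zero_add] at hlz
  let _ : Invertible lzInv := ⟨lz, by rw [mul_comm]; exact lzInv_mul_lz, lzInv_mul_lz⟩
  intro h
  exact hlz ((Polynomial.eval₂_reverse_eq_zero_iff _ lzInv p).2 h)

/-- The Laurent expansion of a rational function at a point of the Riemann sphere, in the local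
coordinate `x - u` or `1/x`. -/
noncomputable def expand : OnePoint ℂ → (RatFunc ℂ →+* LaurentSeries ℂ)
  | some u => evalHom (HahnSeries.C u + lz) (eval₂_shift_ne_zero u)
  | none => evalHom lzInv eval₂_lzInv_ne_zero

lemma localCoeff_coe {m : ℕ} (A : Matrix (Fin m) (Fin m) (RatFunc ℂ)) (u : ℂ) :
    localCoeff A (u : OnePoint ℂ) = A.map (expand (u : OnePoint ℂ)) := rfl

lemma localCoeff_infty_apply {m : ℕ} (A : Matrix (Fin m) (Fin m) (RatFunc ℂ)) (i j : Fin m) :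
    localCoeff A OnePoint.infty i j = -(lzInv * (lzInv * expand OnePoint.infty (A i j))) := by
  have h2 : (HahnSeries.single (-2) 1 : LaurentSeries ℂ) = lzInv * lzInv := by
    simp [lzInv, HahnSeries.single_mul_single]
  have h3 : localCoeff A OnePoint.infty i j =
      -HahnSeries.single (-2) 1 * expand OnePoint.infty (A i j) := rfl
  rw [h3, h2]
  ring

lemma expand_C (p : OnePoint ℂ) (c : ℂ) : expand p (RatFunc.C c) = HahnSeries.C c := by
  cases p <;> exact RatFunc.eval_C _ _

lemma expand_X_coe (u : ℂ) : expand (u : OnePoint ℂ) RatFunc.X = HahnSeries.C u + lz :=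
  RatFunc.eval_X _ _

lemma expand_X_infty : expand OnePoint.infty RatFunc.X = lzInv :=
  RatFunc.eval_X _ _

/-! ### Partial fractions with simple poles -/

/-- The matrix `∑ k, R k / (x - u k) + S` of rational functions. -/
noncomputable def pfrac {m : ℕ} {κ : Type} [Fintype κ] (u : κ → ℂ)
    (R : κ → Matrix (Fin m) (Fin m) ℂ) (S : Matrix (Fin m) (Fin m) ℂ) :
    Matrix (Fin m) (Fin m) (RatFunc ℂ) :=
  Matrix.of fun i j =>
    ∑ k, RatFunc.C (R k i j) * (RatFunc.X - RatFunc.C (u k))⁻¹ + RatFunc.C (S i j)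

/-- The local coefficient matrix at `p` is `z⁻¹` times a power series with constant term `R`. -/
def HasSimplePole {m : ℕ} (A : Matrix (Fin m) (Fin m) (RatFunc ℂ)) (p : OnePoint ℂ)
    (R : Matrix (Fin m) (Fin m) ℂ) : Prop :=
  ∃ B : Matrix (Fin m) (Fin m) (PowerSeries ℂ),
    localCoeff A p = lzInv • B.map ofPS ∧ B.map (PowerSeries.constantCoeff (R := ℂ)) = R

lemma C_eq_ofPS (c : ℂ) : (HahnSeries.C c : LaurentSeries ℂ) = ofPS (PowerSeries.C c) :=
  (HahnSeries.ofPowerSeries_C c).symm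

lemma lz_eq_ofPS : lz = ofPS PowerSeries.X := HahnSeries.ofPowerSeries_X.symm

lemma lzInv_mul_lz_mul (f : LaurentSeries ℂ) : lzInv * (lz * f) = f := by
  rw [← mul_assoc, lzInv_mul_lz, one_mul]

lemma ofPS_inv_eq {f : PowerSeries ℂ} (hf : PowerSeries.constantCoeff f ≠ 0) :
    (ofPS f)⁻¹ = ofPS f⁻¹ := by
  symm
  apply eq_inv_of_mul_eq_one_left
  rw [← map_mul, PowerSeries.inv_mul_cancel _ hf, map_one]

lemma expand_inv_of_ne {p u : ℂ} (h : p ≠ u) :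
    expand (p : OnePoint ℂ) (RatFunc.X - RatFunc.C u)⁻¹ =
      ofPS (PowerSeries.C (p - u) + PowerSeries.X)⁻¹ := by
  rw [map_inv₀, map_sub, expand_X_coe, expand_C, ← ofPS_inv_eq (by simpa using sub_ne_zero.2 h)]
  congr 1
  rw [map_add, ← C_eq_ofPS, ← lz_eq_ofPS, map_sub]
  ring

lemma expand_inv_self (u : ℂ) :
    expand (u : OnePoint ℂ) (RatFunc.X - RatFunc.C u)⁻¹ = lzInv := by
  rw [map_inv₀, map_sub, expand_X_coe, expand_C, add_sub_cancel_left, lzInv_eq]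

lemma expand_inv_infty (u : ℂ) :
    expand OnePoint.infty (RatFunc.X - RatFunc.C u)⁻¹ =
      lz * ofPS (1 - PowerSeries.C u * PowerSeries.X)⁻¹ := by
  rw [map_inv₀, map_sub, expand_X_infty, expand_C, ← ofPS_inv_eq (by simp), lzInv_eq]
  have : (lz⁻¹ - HahnSeries.C u : LaurentSeries ℂ) =
      lz⁻¹ * ofPS (1 - PowerSeries.C u * PowerSeries.X) := by
    rw [map_sub, map_one, map_mul, ← C_eq_ofPS, ← lz_eq_ofPS, mul_sub, mul_one]
    field_simp [lz_ne_zero]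
  rw [this, mul_inv, inv_inv]

section
variable {m : ℕ} {κ : Type} [Fintype κ] (u : κ → ℂ) (R : κ → Matrix (Fin m) (Fin m) ℂ)
  (S : Matrix (Fin m) (Fin m) ℂ)

lemma expand_pfrac (p : OnePoint ℂ) (i j : Fin m) :
    expand p (pfrac u R S i j) =
      ∑ k, HahnSeries.C (R k i j) * expand p (RatFunc.X - RatFunc.C (u k))⁻¹ +
        HahnSeries.C (S i j) := by
  simp only [pfrac, Matrix.of_apply, map_add, map_sum, map_mul, expand_C]

lemma pfrac_isNonsingularAt {p : ℂ} (hp : ∀ k, p ≠ u k) :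
    IsNonsingularAt (pfrac u R S) (p : OnePoint ℂ) := by
  refine ⟨Matrix.of fun i j => ∑ k, PowerSeries.C (R k i j) *
    (PowerSeries.C (p - u k) + PowerSeries.X)⁻¹ + PowerSeries.C (S i j), ?_⟩
  ext1 i j
  rw [localCoeff_coe, Matrix.map_apply, Matrix.map_apply, expand_pfrac, Matrix.of_apply, map_add,
    map_sum, ← C_eq_ofPS]
  congr 1
  refine Finset.sum_congr rfl fun k _ => ?_
  rw [expand_inv_of_ne (hp k), map_mul, ← C_eq_ofPS]

lemma pfrac_hasSimplePole [DecidableEq κ] (hu : Function.Injective u) (k : κ) :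
    HasSimplePole (pfrac u R S) (u k : OnePoint ℂ) (R k) := by
  refine ⟨Matrix.of fun i j => PowerSeries.C (R k i j) + PowerSeries.X *
    (∑ l ∈ Finset.univ.erase k, PowerSeries.C (R l i j) *
      (PowerSeries.C (u k - u l) + PowerSeries.X)⁻¹ + PowerSeries.C (S i j)), ?_, ?_⟩
  · ext1 i j
    rw [localCoeff_coe, Matrix.map_apply, expand_pfrac, Matrix.smul_apply, Matrix.map_apply,
      Matrix.of_apply, ← Finset.add_sum_erase _ _ (Finset.mem_univ k), expand_inv_self, map_add,
      map_mul, ← lz_eq_ofPS, smul_eq_mul, mul_add, lzInv_mul_lz_mul, map_add, map_sum,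
      ← C_eq_ofPS, ← C_eq_ofPS, mul_comm lzInv, add_assoc]
    congr 2
    refine Finset.sum_congr rfl fun l hl => ?_
    rw [expand_inv_of_ne fun h => Finset.ne_of_mem_erase hl (hu h).symm, map_mul, ← C_eq_ofPS]
  · ext1 i j
    simp

lemma pfrac_hasSimplePole_infty :
    HasSimplePole (pfrac u R 0) OnePoint.infty (-∑ k, R k) := by
  refine ⟨Matrix.of fun i j => -∑ k, PowerSeries.C (R k i j) *
    (1 - PowerSeries.C (u k) * PowerSeries.X)⁻¹, ?_, ?_⟩
  · ext1 i j
    have key : ∑ k, HahnSeries.C (R k i j) *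
        expand OnePoint.infty (RatFunc.X - RatFunc.C (u k))⁻¹ =
        lz * ofPS (∑ k, PowerSeries.C (R k i j) *
          (1 - PowerSeries.C (u k) * PowerSeries.X)⁻¹) := by
      rw [map_sum, Finset.mul_sum]
      refine Finset.sum_congr rfl fun k _ => ?_
      rw [expand_inv_infty, map_mul, ← C_eq_ofPS]
      ring
    rw [localCoeff_infty_apply, expand_pfrac, key, Matrix.smul_apply, Matrix.map_apply,
      Matrix.of_apply, Matrix.zero_apply, map_zero, add_zero, map_neg, smul_eq_mul,
      lzInv_mul_lz_mul]
    ring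
  · ext1 i j
    simp [Matrix.sum_apply]

/-- At infinity, the system with coefficient matrix `R / x + S` has the local coefficient matrix
`-S z⁻² - R z⁻¹`. -/
lemma localCoeff_infty_pfrac_unique [Unique κ] (hu : u default = 0) :
    localCoeff (pfrac u R S) OnePoint.infty =
      (lzInv * lzInv) • ((-S).map HahnSeries.C + lz • (-R default).map HahnSeries.C) := by
  ext1 i j
  have key : expand OnePoint.infty (RatFunc.X - RatFunc.C 0)⁻¹ = lz := by
    rw [map_inv₀, map_sub, expand_X_infty, expand_C, map_zero, sub_zero, lzInv_eq, inv_inv]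
  rw [localCoeff_infty_apply, expand_pfrac, Fintype.sum_unique, hu, key,
    Matrix.smul_apply, Matrix.add_apply, Matrix.smul_apply, Matrix.map_apply, Matrix.map_apply,
    Matrix.neg_apply, Matrix.neg_apply, map_neg, map_neg, smul_eq_mul, smul_eq_mul]
  ring

end

/-! ### Values of rational functions -/

/-- The rational function `f` has no pole at `x`, where its value is `c`. -/
def HasValue (f : RatFunc ℂ) (x c : ℂ) : Prop :=
  f.denom.eval x ≠ 0 ∧ f.eval (RingHom.id ℂ) x = c

lemma hasValue_C (x c : ℂ) : HasValue (RatFunc.C c) x c :=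
  ⟨by simp, by simp [RatFunc.eval_C]⟩

lemma HasValue.add {f g : RatFunc ℂ} {x c d : ℂ} (hf : HasValue f x c) (hg : HasValue g x d) :
    HasValue (f + g) x (c + d) := by
  refine ⟨fun h => ?_, ?_⟩
  · obtain ⟨q, hq⟩ := RatFunc.denom_add_dvd f g
    have := congrArg (Polynomial.eval x) hq
    rw [Polynomial.eval_mul, Polynomial.eval_mul, h, zero_mul] at this
    exact mul_ne_zero hf.1 hg.1 this
  · rw [RatFunc.eval_add (RingHom.id ℂ) x hf.1 hg.1, hf.2, hg.2]

lemma HasValue.mul {f g : RatFunc ℂ} {x c d : ℂ} (hf : HasValue f x c) (hg : HasValue g x d) :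
    HasValue (f * g) x (c * d) := by
  refine ⟨fun h => ?_, ?_⟩
  · obtain ⟨q, hq⟩ := RatFunc.denom_mul_dvd f g
    have := congrArg (Polynomial.eval x) hq
    rw [Polynomial.eval_mul, Polynomial.eval_mul, h, zero_mul] at this
    exact mul_ne_zero hf.1 hg.1 this
  · rw [RatFunc.eval_mul (RingHom.id ℂ) x hf.1 hg.1, hf.2, hg.2]

lemma HasValue.sum {κ : Type} (s : Finset κ) {f : κ → RatFunc ℂ} {x : ℂ} {c : κ → ℂ}
    (h : ∀ k, HasValue (f k) x (c k)) : HasValue (∑ k ∈ s, f k) x (∑ k ∈ s, c k) := by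
  classical
  induction s using Finset.induction_on with
  | empty => simpa using hasValue_C x 0
  | insert a s ha ih =>
    rw [Finset.sum_insert ha, Finset.sum_insert ha]
    exact (h a).add ih

lemma hasValue_inv {x u : ℂ} (hx : x ≠ u) :
    HasValue (RatFunc.X - RatFunc.C u)⁻¹ x (x - u)⁻¹ := by
  have h0 : (RatFunc.X - RatFunc.C u : RatFunc ℂ) ≠ 0 := by
    rw [← RatFunc.algebraMap_X, ← RatFunc.algebraMap_C, ← map_sub]
    exact RatFunc.algebraMap_ne_zero (Polynomial.X_sub_C_ne_zero u)
  have hnum : (RatFunc.X - RatFunc.C u : RatFunc ℂ).num = Polynomial.X - Polynomial.C u := by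
    rw [← RatFunc.algebraMap_X, ← RatFunc.algebraMap_C, ← map_sub, RatFunc.num_algebraMap]
  have hd : (RatFunc.X - RatFunc.C u : RatFunc ℂ)⁻¹.denom.eval x ≠ 0 := by
    intro h
    obtain ⟨q, hq⟩ := RatFunc.denom_inv_dvd h0
    have := congrArg (Polynomial.eval x) hq
    rw [hnum, Polynomial.eval_mul, h, zero_mul] at this
    simp [sub_ne_zero.2 hx] at this
  refine ⟨hd, ?_⟩
  have hs : HasValue (RatFunc.X - RatFunc.C u) x (x - u) := by
    have h1 : HasValue RatFunc.X x x := ⟨by simp, RatFunc.eval_X _ _⟩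
    have := h1.add (hasValue_C x (-u))
    simpa [sub_eq_add_neg] using this
  have := (HasValue.mul ⟨hd, rfl⟩ hs).2
  rw [inv_mul_cancel₀ h0, RatFunc.eval_one] at this
  exact eq_inv_of_mul_eq_one_left this.symm

lemma hasValue_pfrac {m : ℕ} {κ : Type} [Fintype κ] (u : κ → ℂ)
    (R : κ → Matrix (Fin m) (Fin m) ℂ) (S : Matrix (Fin m) (Fin m) ℂ) {x : ℂ}
    (hx : ∀ k, x ≠ u k) (i j : Fin m) :
    HasValue (pfrac u R S i j) x ((∑ k, (x - u k)⁻¹ • R k + S) i j) := by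
  have h1 : (∑ k, (x - u k)⁻¹ • R k + S) i j = ∑ k, R k i j * (x - u k)⁻¹ + S i j := by
    simp [Matrix.sum_apply, mul_comm]
  rw [h1]
  exact (HasValue.sum _ fun k => (hasValue_C x _).mul (hasValue_inv (hx k))).add (hasValue_C x _)

lemma evalAt_pfrac {m : ℕ} {κ : Type} [Fintype κ] (u : κ → ℂ)
    (R : κ → Matrix (Fin m) (Fin m) ℂ) (S : Matrix (Fin m) (Fin m) ℂ) {x : ℂ}
    (hx : ∀ k, x ≠ u k) : evalAt (pfrac u R S) x = ∑ k, (x - u k)⁻¹ • R k + S := by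
  ext1 i j
  exact (hasValue_pfrac u R S hx i j).2

/-- A subspace invariant under the values of `∑ k, R k / (x - u k) + S` is invariant under the
residues `R k`. -/
lemma mem_of_pfrac_invariant {m : ℕ} {κ : Type} [Fintype κ] [DecidableEq κ] {u : κ → ℂ}
    (hu : Function.Injective u)
    (R : κ → Matrix (Fin m) (Fin m) ℂ) (S : Matrix (Fin m) (Fin m) ℂ)
    (V : Submodule ℂ (Fin m → ℂ))
    (hV : ∀ x : ℂ, (∀ i j, (pfrac u R S i j).denom.eval x ≠ 0) →
      ∀ v ∈ V, (evalAt (pfrac u R S) x).mulVec v ∈ V) (k : κ) :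
    ∀ v ∈ V, (R k).mulVec v ∈ V := by
  intro v hv
  have hclosed : IsClosed (V : Set (Fin m → ℂ)) := V.closed_of_finiteDimensional
  have hne : ∀ᶠ x in 𝓝[≠] (u k), ∀ l, x ≠ u l := by
    rw [Filter.eventually_all]
    intro l
    by_cases hl : l = k
    · subst hl
      exact eventually_mem_nhdsWithin
    · exact eventually_nhdsWithin_of_eventually_nhds (isOpen_ne.mem_nhds fun h => hl (hu h).symm)
  -- the residue is the limit of `(x - u k) A(x)` as `x` tends to `u k`
  let g : ℂ → (Fin m → ℂ) := fun x => ((R k).mulVec v) + (x - u k) •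
    ((∑ l ∈ Finset.univ.erase k, (x - u l)⁻¹ • R l + S).mulVec v)
  have hg : ContinuousAt g (u k) := by
    have h1 : ∀ l ∈ Finset.univ.erase k, ContinuousAt (fun x : ℂ => (x - u l)⁻¹ • R l) (u k) := by
      intro l hl
      refine ContinuousAt.smul (ContinuousAt.inv₀ (continuousAt_id.sub continuousAt_const) ?_)
        continuousAt_const
      exact sub_ne_zero.2 fun h => Finset.ne_of_mem_erase hl (hu h).symm
    have h2 : ContinuousAt
        (fun x : ℂ => ∑ l ∈ Finset.univ.erase k, (x - u l)⁻¹ • R l + S) (u k) :=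
      (tendsto_finsetSum _ h1).add continuousAt_const
    refine continuousAt_const.add (ContinuousAt.smul (continuousAt_id.sub continuousAt_const) ?_)
    have h3 : Continuous fun M : Matrix (Fin m) (Fin m) ℂ => M.mulVec v :=
      Continuous.matrix_mulVec continuous_id continuous_const
    exact h3.continuousAt.comp h2
  have hg' : Tendsto g (𝓝[≠] (u k)) (𝓝 ((R k).mulVec v)) := by
    have : g (u k) = (R k).mulVec v := by simp [g]
    rw [← this]
    exact hg.tendsto.mono_left nhdsWithin_le_nhds
  refine hclosed.mem_of_tendsto hg' ?_
  filter_upwards [hne] with x hx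
  have h1 := hV x (fun i j => (hasValue_pfrac u R S hx i j).1) v hv
  rw [evalAt_pfrac u R S hx] at h1
  have h2 := V.smul_mem (x - u k) h1
  have h3 : g x = (x - u k) • (∑ k, (x - u k)⁻¹ • R k + S).mulVec v := by
    rw [← Finset.add_sum_erase _ _ (Finset.mem_univ k), add_assoc, Matrix.add_mulVec, smul_add,
      Matrix.smul_mulVec, smul_smul, mul_inv_cancel₀ (sub_ne_zero.2 (hx k)), one_smul]
  rw [SetLike.mem_coe, h3]
  exact h2

/-! ### Formal gauge transformations to the diagonal form -/

/-- Recursive systems of equations have solutions: if the value of `F v` at `j` depends only on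
the values of `v` at indices of smaller degree, then `F` has a fixed point. -/
lemma exists_fixed_of_graded {ι α : Type} [Inhabited α] (f : ι → ℕ) (F : (ι → α) → ι → α)
    (hF : ∀ v w j, (∀ k, f k < f j → v k = w k) → F v j = F w j) :
    ∃ v : ι → α, ∀ j, v j = F v j := by
  classical
  let W := (measure f).wf
  refine ⟨W.fix fun j rec => F (fun k => if h : f k < f j then rec k h else default) j, ?_⟩
  intro j
  rw [W.fix_eq]
  refine hF _ _ j fun k hk => ?_
  rw [dif_pos hk]

lemma coeff_mul_range (n : ℕ) (f g : PowerSeries ℂ) :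
    PowerSeries.coeff n (f * g) =
      ∑ a ∈ Finset.range n, PowerSeries.coeff a f * PowerSeries.coeff (n - a) g +
        PowerSeries.coeff n f * PowerSeries.constantCoeff g := by
  rw [PowerSeries.coeff_mul, Finset.Nat.sum_antidiagonal_eq_sum_range_succ
    (fun a b => PowerSeries.coeff a f * PowerSeries.coeff b g), Finset.sum_range_succ,
    Nat.sub_self, PowerSeries.coeff_zero_eq_constantCoeff_apply]

lemma coeff_X_mul_derivative (n : ℕ) (g : PowerSeries ℂ) :
    PowerSeries.coeff n (PowerSeries.X * PowerSeries.derivative ℂ g) =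
      n * PowerSeries.coeff n g := by
  cases n with
  | zero => simp
  | succ n =>
    rw [PowerSeries.coeff_succ_X_mul, PowerSeries.coeff_derivative]
    push_cast
    ring

lemma isUnit_of_constantCoeff {m : ℕ} (G : Matrix (Fin m) (Fin m) (PowerSeries ℂ))
    (hG : G.map (PowerSeries.constantCoeff (R := ℂ)) = 1) : IsUnit G := by
  rw [Matrix.isUnit_iff_isUnit_det, PowerSeries.isUnit_iff_constantCoeff, RingHom.map_det,
    RingHom.mapMatrix_apply, hG, Matrix.det_one]
  exact isUnit_one

/-- At a regular singular point with a diagonal non-resonant residue, the recursion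
`G_n (d_j - d_i + n) = …` yields a formal gauge transformation to `diag d / z`. -/
lemma exists_gauge_regular {m : ℕ} (B : Matrix (Fin m) (Fin m) (PowerSeries ℂ)) (d : Fin m → ℂ)
    (hB : B.map (PowerSeries.constantCoeff (R := ℂ)) = Matrix.diagonal d)
    (hd : ∀ (i j : Fin m) (n : ℤ), d i - d j = (n : ℂ) → n = 0) :
    ∃ G : Matrix (Fin m) (Fin m) (PowerSeries ℂ),
      G.map (PowerSeries.constantCoeff (R := ℂ)) = 1 ∧
      G * B + G.map (fun f => PowerSeries.X * PowerSeries.derivative ℂ f) =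
        Matrix.diagonal (fun i => PowerSeries.C (d i)) * G := by
  obtain ⟨g, hg⟩ := exists_fixed_of_graded (ι := ℕ × Fin m × Fin m) (α := ℂ) (fun x => x.1)
    (fun v x => if x.1 = 0 then (1 : Matrix (Fin m) (Fin m) ℂ) x.2.1 x.2.2 else
      -(∑ l, ∑ a ∈ Finset.range x.1, v (a, x.2.1, l) *
        PowerSeries.coeff (x.1 - a) (B l x.2.2)) / (d x.2.2 - d x.2.1 + x.1)) (by
      rintro v w ⟨n, i, j⟩ h
      dsimp only
      congr 2
      congr 1
      refine Finset.sum_congr rfl fun l _ => Finset.sum_congr rfl fun a ha => ?_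
      rw [h (a, i, l) (Finset.mem_range.1 ha)])
  have hB0 : ∀ l j, PowerSeries.constantCoeff (B l j) = Matrix.diagonal d l j := fun l j =>
    congrFun (congrFun hB l) j
  refine ⟨Matrix.of fun i j => PowerSeries.mk fun n => g (n, i, j), ?_, ?_⟩
  · ext1 i j
    rw [Matrix.map_apply, Matrix.of_apply, PowerSeries.constantCoeff_mk, hg]
    simp
  · ext i j n
    rw [Matrix.diagonal_mul, Matrix.add_apply, Matrix.mul_apply, Matrix.map_apply, map_add,
      map_sum, coeff_X_mul_derivative, PowerSeries.coeff_C_mul]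
    simp only [coeff_mul_range, Matrix.of_apply, PowerSeries.coeff_mk, Finset.sum_add_distrib, hB0]
    rw [Finset.sum_eq_single (s := Finset.univ)
      (f := fun l => g (n, i, l) * Matrix.diagonal d l j) j
      (fun l _ hl => by rw [Matrix.diagonal_apply_ne _ hl, mul_zero]) (by simp),
      Matrix.diagonal_apply_eq]
    rcases Nat.eq_zero_or_pos n with rfl | hn
    · rw [hg]
      by_cases hij : i = j
      · subst hij; simp
      · simp [hij]
    · have hne : d j - d i + (n : ℂ) ≠ 0 := by
        intro h
        have := hd i j n (by push_cast; linear_combination -h)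
        omega
      have h1 := hg (n, i, j)
      dsimp only at h1
      rw [if_neg hn.ne', eq_div_iff hne] at h1
      linear_combination h1

/-- At a singular point `T/z² + N/z`, with `T = diag t` and with the diagonal blocks of `N`
along the eigenspaces of `T` diagonal, a formal gauge transformation removes the off-diagonal
blocks of `N`. The coefficients `G_n` are determined in the order: off-diagonal blocks of `G_n`,
from the coefficient of `z^{n-2}`, then diagonal blocks of `G_n`, from that of `z^{n-1}`. -/
lemma exists_gauge_rankOne {m : ℕ} (t d : Fin m → ℂ) (N : Matrix (Fin m) (Fin m) ℂ)
    (hN : ∀ i j, t i = t j → N i j = Matrix.diagonal d i j)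
    (hd : ∀ (i j : Fin m) (n : ℤ), d i - d j = (n : ℂ) → n = 0) :
    ∃ G : Matrix (Fin m) (Fin m) (PowerSeries ℂ),
      G.map (PowerSeries.constantCoeff (R := ℂ)) = 1 ∧
      G * (Matrix.diagonal fun i => PowerSeries.C (t i)) +
          (PowerSeries.X : PowerSeries ℂ) • (G * N.map PowerSeries.C) +
          G.map (fun f => PowerSeries.X * (PowerSeries.X * PowerSeries.derivative ℂ f)) =
        Matrix.diagonal (fun i => PowerSeries.C (t i) + PowerSeries.X * PowerSeries.C (d i)) *
          G := by
  classical
  obtain ⟨g, hg⟩ := exists_fixed_of_graded (ι := ℕ × Fin m × Fin m) (α := ℂ)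
    (fun x => 2 * x.1 + if t x.2.1 = t x.2.2 then 1 else 0)
    (fun v x => if x.1 = 0 then (1 : Matrix (Fin m) (Fin m) ℂ) x.2.1 x.2.2 else
      if t x.2.1 = t x.2.2 then
        -(∑ l with t l ≠ t x.2.2, v (x.1, x.2.1, l) * N l x.2.2) / (d x.2.2 - d x.2.1 + x.1)
      else -(∑ l, v (x.1 - 1, x.2.1, l) * N l x.2.2 +
        ((x.1 - 1 : ℕ) - d x.2.1) * v (x.1 - 1, x.2.1, x.2.2)) / (t x.2.2 - t x.2.1)) (by
      rintro v w ⟨n, i, j⟩ h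
      dsimp only at h ⊢
      split_ifs with h0 h1
      · rfl
      · congr 2
        refine Finset.sum_congr rfl fun l hl => ?_
        rw [h (n, i, l)]
        have : t j ≠ t l := (Finset.mem_filter.1 hl).2.symm
        simp [this, h1]
      · have h2 : ∀ l, v (n - 1, i, l) = w (n - 1, i, l) := by
          intro l
          apply h
          dsimp only
          split_ifs <;> omega
        simp only [h2])
  have hg0 : ∀ i j, g (0, i, j) = (1 : Matrix (Fin m) (Fin m) ℂ) i j := fun i j => by
    rw [hg]; simp
  -- the equation which determines the off-diagonal blocks
  have hoff : ∀ n i j, t i ≠ t j → g (n + 1, i, j) * (t j - t i) +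
      (∑ l, g (n, i, l) * N l j) + (n - d i) * g (n, i, j) = 0 := by
    intro n i j h
    have h1 := hg (n + 1, i, j)
    dsimp only at h1
    rw [if_neg n.succ_ne_zero, if_neg h, eq_div_iff (sub_ne_zero.2 h.symm)] at h1
    rw [h1]
    simp only [Nat.add_sub_cancel]
    ring
  -- the equation which determines the diagonal blocks
  have hdiag : ∀ n i j, t i = t j →
      (∑ l, g (n, i, l) * N l j) + (n - d i) * g (n, i, j) = 0 := by
    intro n i j h
    rw [← Finset.sum_filter_add_sum_filter_not Finset.univ (fun l => t l ≠ t j)]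
    have h3 : ∑ l with ¬ t l ≠ t j, g (n, i, l) * N l j = g (n, i, j) * d j := by
      rw [Finset.sum_eq_single j]
      · rw [hN j j rfl, Matrix.diagonal_apply_eq]
      · intro l hl hlj
        rw [hN l j (not_not.1 (Finset.mem_filter.1 hl).2), Matrix.diagonal_apply_ne _ hlj, mul_zero]
      · simp
    rw [h3]
    rcases Nat.eq_zero_or_pos n with rfl | hn
    · rw [Finset.sum_eq_zero]
      · rw [hg0]
        by_cases hij : i = j
        · subst hij; simp
        · simp [hij]
      · intro l hl
        have : i ≠ l := fun h2 => (Finset.mem_filter.1 hl).2 (h2 ▸ h)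
        rw [hg0, Matrix.one_apply_ne this, zero_mul]
    · have hne : d j - d i + (n : ℂ) ≠ 0 := by
        intro h
        have := hd i j n (by push_cast; linear_combination -h)
        omega
      have h1 := hg (n, i, j)
      dsimp only at h1
      rw [if_neg hn.ne', if_pos h, eq_div_iff hne] at h1
      linear_combination h1
  refine ⟨Matrix.of fun i j => PowerSeries.mk fun n => g (n, i, j), ?_, ?_⟩
  · ext1 i j
    rw [Matrix.map_apply, Matrix.of_apply, PowerSeries.constantCoeff_mk, hg0]
  · ext i j n
    rw [Matrix.diagonal_mul, Matrix.add_apply, Matrix.add_apply, Matrix.mul_diagonal,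
      Matrix.map_apply, Matrix.smul_apply, Matrix.mul_apply, add_mul, mul_assoc PowerSeries.X,
      map_add, map_add, map_add, smul_eq_mul, mul_comm _ (PowerSeries.C (t j)),
      PowerSeries.coeff_C_mul, PowerSeries.coeff_C_mul]
    rcases n with _ | n
    · simp only [PowerSeries.coeff_zero_X_mul, Matrix.of_apply, PowerSeries.coeff_mk, hg0, add_zero]
      by_cases hij : i = j
      · subst hij; rfl
      · rw [Matrix.one_apply_ne hij, mul_zero, mul_zero]
    · rw [PowerSeries.coeff_succ_X_mul, PowerSeries.coeff_succ_X_mul, PowerSeries.coeff_succ_X_mul,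
        coeff_X_mul_derivative, PowerSeries.coeff_C_mul, map_sum]
      simp only [Matrix.of_apply, Matrix.map_apply, PowerSeries.coeff_mul_C, PowerSeries.coeff_mk]
      by_cases h : t i = t j
      · rw [h]
        linear_combination hdiag n i j h
      · linear_combination hoff n i j h

/-! ### Sizes of the level sets -/

/-- The values of `F` on the level sets of `d` in `s`, one for each value taken by `d`. -/
def levelMap {ι α γ : Type} [DecidableEq α] (s : Finset ι) (d : ι → α) (F : Finset ι → γ) :
    Multiset γ :=
  (s.image d).val.map fun c => F (s.filter fun i => d i = c)

/-- The partition formed by the multiplicities of the values of `d`. -/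
def mults {ι α : Type} [Fintype ι] [DecidableEq α] (d : ι → α) : Multiset ℕ :=
  levelMap Finset.univ d Finset.card

/-- The partition of the multiplicities of the values of `β`, each of them partitioned according
to the values of `d`. -/
def mults₂ {ι α γ : Type} [Fintype ι] [DecidableEq α] [DecidableEq γ] (β : ι → α) (d : ι → γ) :
    Multiset (Multiset ℕ) :=
  levelMap Finset.univ β fun s => levelMap s d Finset.card

lemma levelMap_congr_fun {ι α γ : Type} [DecidableEq α] (s : Finset ι) (d : ι → α)
    {F F' : Finset ι → γ} (h : ∀ s, F s = F' s) : levelMap s d F = levelMap s d F' := by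
  rw [funext h]

lemma levelMap_of_iff {ι α α' γ : Type} [DecidableEq α] [DecidableEq α'] (s : Finset ι)
    (d : ι → α) (d' : ι → α') (F : Finset ι → γ) (h : ∀ i j, d i = d j ↔ d' i = d' j) :
    levelMap s d F = levelMap s d' F := by
  rcases isEmpty_or_nonempty ι with hι | hι
  · have : s = ∅ := Finset.eq_empty_of_isEmpty s
    subst this
    rfl
  · let g : α → α' := fun c => d' (Function.invFun d c)
    have hg : ∀ i, g (d i) = d' i := fun i =>
      (h _ _).1 (Function.invFun_eq (f := d) (b := d i) ⟨i, rfl⟩)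
    have himg : s.image d' = (s.image d).image g := by
      rw [Finset.image_image]
      exact Finset.image_congr fun i _ => (hg i).symm
    have hinj : Set.InjOn g (s.image d) := by
      intro a ha b hb hab
      obtain ⟨i, -, rfl⟩ := Finset.mem_image.1 (Finset.mem_coe.1 ha)
      obtain ⟨j, -, rfl⟩ := Finset.mem_image.1 (Finset.mem_coe.1 hb)
      rw [hg, hg] at hab
      exact (h _ _).2 hab
    rw [levelMap, levelMap, himg, Finset.image_val_of_injOn hinj, Multiset.map_map]
    refine Multiset.map_congr rfl fun c hc => ?_
    obtain ⟨i, -, rfl⟩ := Finset.mem_image.1 hc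
    rw [Function.comp_apply, hg]
    congr 1
    ext j
    simp only [Finset.mem_filter, h]

lemma mults_of_iff {ι α α' : Type} [Fintype ι] [DecidableEq α] [DecidableEq α']
    (d : ι → α) (d' : ι → α') (h : ∀ i j, d i = d j ↔ d' i = d' j) : mults d = mults d' :=
  levelMap_of_iff _ _ _ _ h

lemma mults_comp_equiv {ι κ α : Type} [Fintype ι] [Fintype κ] [DecidableEq α] (e : ι ≃ κ)
    (d : κ → α) : mults (d ∘ e) = mults d := by
  classical
  rw [mults, mults, levelMap, levelMap]
  have : Finset.univ.image (d ∘ e) = Finset.univ.image d := by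
    rw [← Finset.image_image, Finset.image_univ_equiv]
  rw [this]
  refine Multiset.map_congr rfl fun c _ => ?_
  refine Finset.card_bij (fun i _ => e i) (by simp) (by simp) fun j hj => ?_
  exact ⟨e.symm j, by simpa using hj, by simp⟩

lemma nestedOf_one {m : ℕ} (t : Fin (0 + 1) → Fin m → ℂ) :
    nestedOf (0 + 1) t Finset.univ = mults (t 0) := rfl

lemma nestedOf_two {m : ℕ} (t : Fin (1 + 1) → Fin m → ℂ) :
    nestedOf (1 + 1) t Finset.univ = mults₂ (t 0) (t 1) := rfl

/-! ### Recognition of local types -/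

-- The next three identities are stated for Laurent series, because the search for the scalar
-- actions of a general lemma is slow there.

lemma laurent_smul_mul {m : ℕ} (a : LaurentSeries ℂ)
    (M N : Matrix (Fin m) (Fin m) (LaurentSeries ℂ)) : (a • M) * N = a • (M * N) :=
  Matrix.smul_mul a M N

lemma laurent_smul_add {m : ℕ} (a : LaurentSeries ℂ)
    (M N : Matrix (Fin m) (Fin m) (LaurentSeries ℂ)) : a • (M + N) = a • M + a • N :=
  smul_add a M N

lemma laurent_mul_smul {m : ℕ} (a : LaurentSeries ℂ)
    (M N : Matrix (Fin m) (Fin m) (LaurentSeries ℂ)) : M * (a • N) = a • (M * N) :=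
  Matrix.mul_smul M a N

/-- `R` is diagonalizable, with eigenvalues `d` (with their multiplicities). -/
def DiagonalizableTo {m : ℕ} (R : Matrix (Fin m) (Fin m) ℂ) (d : Fin m → ℂ) : Prop :=
  ∃ W : GL (Fin m) ℂ, W.val * R = Matrix.diagonal d * W.val

lemma htlForm_zero {m : ℕ} (t : Fin (0 + 1) → Fin m → ℂ) :
    htlForm t = lzInv • (Matrix.diagonal fun i => PowerSeries.C (t 0 i)).map ofPS := by
  ext1 i j
  by_cases h : i = j
  · subst h
    simp [htlForm, HahnSeries.single_mul_single]
  · simp [htlForm, h]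

lemma htlForm_one {m : ℕ} (t : Fin (1 + 1) → Fin m → ℂ) :
    htlForm t = (lzInv * lzInv) • (Matrix.diagonal fun i =>
      PowerSeries.C (t 0 i) + PowerSeries.X * PowerSeries.C (t 1 i)).map ofPS := by
  ext1 i j
  by_cases h : i = j
  · subst h
    simp [htlForm, HahnSeries.single_mul_single,
      HahnSeries.ofPowerSeries_X, Fin.sum_univ_two, mul_add]
  · simp [htlForm, h]

/-- A simple pole with a diagonalizable non-resonant residue is a regular singular point, and its
spectral type is given by the multiplicities of the eigenvalues of the residue. -/
lemma HasSimplePole.hasLocalType {m : ℕ}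
    {A : Matrix (Fin m) (Fin m) (RatFunc ℂ)} {p : OnePoint ℂ}
    {R : Matrix (Fin m) (Fin m) ℂ} (h : HasSimplePole A p R) {d : Fin m → ℂ}
    (hR : DiagonalizableTo R d) (hd0 : d ≠ 0)
    (hd : ∀ (i j : Fin m) (n : ℤ), d i - d j = (n : ℂ) → n = 0) {l : Multiset ℕ}
    (hl : mults d = l) : HasLocalType A p (regularType l) := by
  obtain ⟨B, hAB, hBR⟩ := h
  obtain ⟨W, hW⟩ := hR
  let Wm : Matrix (Fin m) (Fin m) (PowerSeries ℂ) := W.val.map PowerSeries.C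
  let Wi : Matrix (Fin m) (Fin m) (PowerSeries ℂ) := W⁻¹.val.map PowerSeries.C
  have hone : (1 : Matrix (Fin m) (Fin m) ℂ).map (PowerSeries.C : ℂ →+* PowerSeries ℂ) = 1 :=
    Matrix.map_one _ (map_zero _) (map_one _)
  have hmi : Wm * Wi = 1 := by rw [← Matrix.map_mul, Units.mul_inv, hone]
  have him : Wi * Wm = 1 := by rw [← Matrix.map_mul, Units.inv_mul, hone]
  have hWm : Wm.map (PowerSeries.constantCoeff (R := ℂ)) = W.val := by
    ext1 i j
    exact PowerSeries.constantCoeff_C _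
  have hWi : Wi.map (PowerSeries.constantCoeff (R := ℂ)) = W⁻¹.val := by
    ext1 i j
    exact PowerSeries.constantCoeff_C _
  obtain ⟨G, hG1, hG⟩ := exists_gauge_regular (Wm * B * Wi) d (by
    rw [Matrix.map_mul, Matrix.map_mul, hWm, hWi, hBR, hW, Matrix.mul_assoc, Units.mul_inv,
      Matrix.mul_one]) hd
  have hGu := isUnit_of_constantCoeff G hG1
  -- the combined gauge transformation is `G W`, with `W` constant
  refine ⟨fun _ => d, hGu.unit * ⟨Wm, Wi, hmi, him⟩, hd0, hd, ?_, (nestedOf_one _).trans hl⟩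
  have hval : (hGu.unit * ⟨Wm, Wi, hmi, him⟩ : GL (Fin m) (PowerSeries ℂ)).val = G * Wm := rfl
  have hder : (G * Wm).map (fun f => PowerSeries.X * PowerSeries.derivative ℂ f) =
      G.map (fun f => PowerSeries.X * PowerSeries.derivative ℂ f) * Wm := by
    ext1 i j
    simp only [Matrix.map_apply, Matrix.mul_apply, map_sum, Finset.mul_sum]
    refine Finset.sum_congr rfl fun l _ => ?_
    have h0 : PowerSeries.derivative ℂ (Wm l j) = 0 := PowerSeries.derivative_C
    rw [Derivation.leibniz, h0, smul_zero, zero_add, smul_eq_mul]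
    ring
  clear_value Wm Wi
  have key : G * Wm * B +
      (G * Wm).map (fun f => PowerSeries.X * PowerSeries.derivative ℂ f) =
      Matrix.diagonal (fun i => PowerSeries.C (d i)) * (G * Wm) := by
    have h1 : G * (Wm * B * Wi) * Wm = G * Wm * B := by
      rw [Matrix.mul_assoc G, Matrix.mul_assoc (Wm * B), him, Matrix.mul_one, Matrix.mul_assoc]
    rw [hder, ← Matrix.mul_assoc (Matrix.diagonal _), ← hG, Matrix.add_mul, h1]
  have htl : htlForm (fun _ => d : Fin (0 + 1) → Fin m → ℂ) =
    lzInv • (Matrix.diagonal fun i => PowerSeries.C (d i)).map ofPS := htlForm_zero _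
  have key' := congrArg (fun M => lzInv • M.map ofPS) key
  simp only [Matrix.map_add ofPS (map_add ofPS), Matrix.map_mul, laurent_smul_add] at key'
  rw [IsFormalGauge, hval, hAB]
  refine Eq.trans ?_ ((key'.trans (laurent_smul_mul _ _ _).symm).trans
    (congrArg₂ _ htl.symm (Matrix.map_mul).symm))
  rw [laurent_mul_smul, Matrix.map_mul]
  refine congrArg₂ _ rfl ?_
  ext1 i j
  rw [Matrix.smul_apply, Matrix.map_apply, Matrix.map_apply, Matrix.map_apply, smul_eq_mul,
    map_mul, ← lz_eq_ofPS, lzInv_mul_lz_mul]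

/-- At infinity, the system with coefficient matrix `R / x + diag s`, where the diagonal blocks of
`R` along the eigenspaces of `diag s` are diagonal, has an unramified singular point of Poincaré
rank one. -/
lemma hasLocalType_infty_pfrac {m : ℕ} {κ : Type} [Unique κ]
    (u : κ → ℂ) (R : κ → Matrix (Fin m) (Fin m) ℂ) (s d : Fin m → ℂ) (hu : u default = 0)
    (hs : s ≠ 0) (hR : ∀ i j, s i = s j → R default i j = Matrix.diagonal d i j)
    (hd : ∀ (i j : Fin m) (n : ℤ), d i - d j = (n : ℂ) → n = 0) {μ : Multiset (Multiset ℕ)}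
    (hμ : mults₂ (fun i => -s i) (fun i => -d i) = μ) :
    HasLocalType (pfrac u R (Matrix.diagonal s)) OnePoint.infty (rankOneType μ) := by
  obtain ⟨G, hG1, hG⟩ := exists_gauge_rankOne (fun i => -s i) (fun i => -d i) (-R default) (by
      intro i j h
      rw [Matrix.neg_apply, hR i j (neg_injective h)]
      by_cases hij : i = j
      · subst hij; simp
      · simp [hij]) (by
      intro i j n h
      exact hd j i n (by linear_combination h))
  have hGu := isUnit_of_constantCoeff G hG1
  let t : Fin (1 + 1) → Fin m → ℂ := ![fun i => -s i, fun i => -d i]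
  have hform : IsFormalGauge hGu.unit (localCoeff (pfrac u R (Matrix.diagonal s)) OnePoint.infty)
      (htlForm t) := by
    have hval : (hGu.unit).val = G := rfl
    have htl : htlForm t = (lzInv * lzInv) • (Matrix.diagonal fun i =>
      PowerSeries.C (-s i) + PowerSeries.X * PowerSeries.C (-d i)).map ofPS := htlForm_one t
    rw [IsFormalGauge, hval, localCoeff_infty_pfrac_unique u R _ hu, htl]
    have key' := congrArg (fun M => (lzInv * lzInv) • M.map ofPS) hG
    simp only [Matrix.map_add ofPS (map_add ofPS), Matrix.map_mul, laurent_smul_add] at key'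
    rw [laurent_smul_mul]
    refine Eq.trans ?_ key'
    have hC : (-R default).map (HahnSeries.C : ℂ →+* LaurentSeries ℂ) =
        ((-R default).map PowerSeries.C).map ofPS := by
      ext1 i j
      exact C_eq_ofPS _
    rw [laurent_mul_smul, Matrix.mul_add, laurent_smul_add]
    refine congrArg₂ (· + ·) (congrArg₂ (· + ·)
      (congrArg (fun M => (lzInv * lzInv) • (G.map ofPS * M)) ?_)
      (congrArg (fun M => (lzInv * lzInv) • M) ?_)) ?_
    · ext1 i j
      by_cases hij : i = j
      · subst hij
        simp
      · simp [hij]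
    · ext1 i j
      rw [laurent_mul_smul, Matrix.smul_apply, Matrix.map_apply, Matrix.smul_apply, smul_eq_mul,
        smul_eq_mul, map_mul, ← lz_eq_ofPS, ← Matrix.map_apply (f := ofPS), Matrix.map_mul, hC]
    · ext1 i j
      simp only [Matrix.map_apply, Matrix.smul_apply, smul_eq_mul]
      rw [map_mul, map_mul, ← lz_eq_ofPS, mul_assoc, lzInv_mul_lz_mul, lzInv_mul_lz_mul]
  refine ⟨t, hGu.unit, fun h => hs ?_, fun i j n h => hd j i n ?_, hform, (nestedOf_two t).trans hμ⟩
  · funext i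
    exact neg_eq_zero.1 (congrFun h i)
  · have h' : -d i - -d j = n := h
    linear_combination h'

/-! ### Two families of diagonalizable matrices -/

/-- If `Y X = diag d` is invertible, then `X Y` is diagonalizable with eigenvalues `d`, on the
range of `X`, and `0`, on the kernel of `Y`. -/
lemma diagonalizableTo_of_mul {n c : ℕ} {κ : Type} [Fintype κ] [DecidableEq κ]
    (X : Matrix (Fin n) κ ℂ) (Y : Matrix κ (Fin n) ℂ) (d : κ → ℂ) (hd : ∀ k, d k ≠ 0)
    (h : Y * X = Matrix.diagonal d) (hc : Fintype.card κ + c = n) :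
    ∃ e : κ ⊕ Fin c ≃ Fin n, DiagonalizableTo (X * Y) (Sum.elim d 0 ∘ e.symm) := by
  have hcard : Fintype.card (κ ⊕ Fin c) = n := by rw [Fintype.card_sum, Fintype.card_fin, hc]
  let e : κ ⊕ Fin c ≃ Fin n := Fintype.equivFinOfCardEq hcard
  have hYX : ∀ g : κ → ℂ, Y.mulVec (X.mulVec g) = fun k => d k * g k := by
    intro g
    rw [Matrix.mulVec_mulVec, h]
    funext k
    exact Matrix.mulVec_diagonal d g k
  have hsurj : Function.Surjective Y.mulVecLin := by
    intro w
    refine ⟨X.mulVec fun k => (d k)⁻¹ * w k, ?_⟩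
    rw [Matrix.mulVecLin_apply, hYX]
    funext k
    rw [mul_inv_cancel_left₀ (hd k)]
  have hker : Module.finrank ℂ (LinearMap.ker Y.mulVecLin) = c := by
    have h1 := LinearMap.finrank_range_add_finrank_ker Y.mulVecLin
    rw [LinearMap.range_eq_top.2 hsurj, finrank_top, Module.finrank_fintype_fun_eq_card,
      Module.finrank_fintype_fun_eq_card, Fintype.card_fin] at h1
    omega
  let b := Module.finBasisOfFinrankEq ℂ (LinearMap.ker Y.mulVecLin) hker
  have hb : ∀ l, Y.mulVec (b l : Fin n → ℂ) = 0 := fun l => (b l).2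
  let F : κ ⊕ Fin c → Fin n → ℂ := Sum.elim (fun k => X.col k) (fun l => (b l : Fin n → ℂ))
  have hF : LinearIndependent ℂ F := by
    rw [Fintype.linearIndependent_iff]
    intro g hg
    rw [Fintype.sum_sum_type] at hg
    have h1 : ∑ k, g (Sum.inl k) • F (Sum.inl k) = X.mulVec fun k => g (Sum.inl k) := by
      rw [Matrix.mulVec_eq_sum]
      simp only [F, Sum.elim_inl, op_smul_eq_smul]
      rfl
    have h2 : Y.mulVec (∑ l, g (Sum.inr l) • F (Sum.inr l)) = 0 := by
      rw [← Matrix.mulVecLin_apply, map_sum]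
      refine Finset.sum_eq_zero fun l _ => ?_
      rw [map_smul]
      exact (congrArg _ (hb l)).trans (smul_zero _)
    have h3 : ∀ k, g (Sum.inl k) = 0 := by
      intro k
      have h4 := congrArg Y.mulVec hg
      rw [Matrix.mulVec_add, h2, add_zero, h1, hYX, Matrix.mulVec_zero] at h4
      exact (mul_eq_zero.1 (congrFun h4 k)).resolve_left (hd k)
    have h5 : ∑ l, g (Sum.inr l) • b l = 0 := by
      simp only [h3, zero_smul, Finset.sum_const_zero, zero_add] at hg
      apply Subtype.ext
      rw [Submodule.coe_sum, Submodule.coe_zero, ← hg]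
      rfl
    rintro (k | l)
    · exact h3 k
    · exact Fintype.linearIndependent_iff.1 b.linearIndependent _ h5 l
  let M : Matrix (Fin n) (Fin n) ℂ := Matrix.of fun i j => F (e.symm j) i
  have hM : IsUnit M := by
    rw [← Matrix.linearIndependent_cols_iff_isUnit]
    exact hF.comp _ e.symm.injective
  have hRM : X * Y * M = M * Matrix.diagonal (Sum.elim d 0 ∘ e.symm) := by
    ext1 i j
    have h1 : ∀ x, (X * Y).mulVec (F x) = Sum.elim d 0 x • F x := by
      rintro (k | l)
      · have h6 : F (Sum.inl k) = X.mulVec (Pi.single k 1) := by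
          rw [Matrix.mulVec_single_one]
          rfl
        rw [h6, ← Matrix.mulVec_mulVec, hYX, ← Matrix.mulVec_smul]
        congr 1
        funext k'
        by_cases hk : k' = k
        · subst hk; simp
        · simp [hk]
      · rw [← Matrix.mulVec_mulVec]
        exact (congrArg _ (hb l)).trans (by simp)
    rw [Matrix.mul_diagonal, mul_comm]
    exact congrFun (h1 (e.symm j)) i
  refine ⟨e, hM.unit⁻¹, ?_⟩
  have h1 : hM.unit⁻¹.val * M = 1 := hM.unit.inv_mul
  have h2 : M * hM.unit⁻¹.val = 1 := hM.unit.mul_inv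
  calc hM.unit⁻¹.val * (X * Y) = hM.unit⁻¹.val * (X * Y * M) * hM.unit⁻¹.val := by
        rw [Matrix.mul_assoc, Matrix.mul_assoc (X * Y), h2, Matrix.mul_one]
    _ = Matrix.diagonal (Sum.elim d 0 ∘ e.symm) * hM.unit⁻¹.val := by
        rw [hRM, ← Matrix.mul_assoc, h1, Matrix.one_mul]

/-- A block triangular matrix whose diagonal blocks are diagonal, with no common eigenvalue, is
diagonalizable. -/
lemma diagonalizableTo_of_blockTriangular {n : ℕ} (M : Matrix (Fin n) (Fin n) ℂ) (β : Fin n → ℕ)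
    (d : Fin n → ℂ) (hdiag : ∀ i, M i i = d i) (hM : ∀ i j, β j ≤ β i → i ≠ j → M i j = 0)
    (hd : ∀ i j, β i ≠ β j → d i ≠ d j) : DiagonalizableTo M d := by
  obtain ⟨w, hw⟩ := exists_fixed_of_graded (ι := Fin n × Fin n) (α := ℂ) (fun x => β x.2)
    (fun v x => if β x.2 ≤ β x.1 then (1 : Matrix (Fin n) (Fin n) ℂ) x.1 x.2 else
      (∑ k with β k < β x.2, v (x.1, k) * M k x.2) / (d x.1 - d x.2)) (by
      rintro v w ⟨i, j⟩ h
      dsimp only at h ⊢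
      congr 2
      refine Finset.sum_congr rfl fun k hk => ?_
      rw [h (i, k) (Finset.mem_filter.1 hk).2])
  let W : Matrix (Fin n) (Fin n) ℂ := Matrix.of fun i j => w (i, j)
  have hW : ∀ i j, β j ≤ β i → W i j = (1 : Matrix (Fin n) (Fin n) ℂ) i j := by
    intro i j h
    change w (i, j) = _
    rw [hw]
    exact if_pos h
  have hdet : W.det = 1 := by
    have htri : W.BlockTriangular β := by
      intro i j hij
      rw [hW i j hij.le, Matrix.one_apply_ne]
      rintro rfl
      exact lt_irrefl _ hij
    rw [htri.det]
    refine Finset.prod_eq_one fun a _ => ?_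
    have : W.toSquareBlock β a = 1 := by
      ext1 i j
      rw [Matrix.toSquareBlock_def, Matrix.of_apply, hW _ _ (by rw [i.2, j.2]), Matrix.one_apply,
        Matrix.one_apply]
      simp only [Subtype.ext_iff]
    rw [this, Matrix.det_one]
  have hu : IsUnit W := by rw [Matrix.isUnit_iff_isUnit_det, hdet]; exact isUnit_one
  refine ⟨hu.unit, ?_⟩
  change W * M = Matrix.diagonal d * W
  ext1 i j
  rw [Matrix.diagonal_mul, Matrix.mul_apply,
    ← Finset.sum_filter_add_sum_filter_not Finset.univ (fun k => β k < β j)]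
  have h1 : ∑ k with ¬ β k < β j, W i k * M k j = W i j * d j := by
    rw [Finset.sum_eq_single j]
    · rw [hdiag]
    · intro k hk hkj
      rw [hM k j (not_lt.1 (Finset.mem_filter.1 hk).2) hkj, mul_zero]
    · simp
  rw [h1]
  by_cases hij : β j ≤ β i
  · rw [Finset.sum_eq_zero, hW i j hij]
    · by_cases h2 : i = j
      · subst h2; simp
      · simp [h2]
    · intro k hk
      have hlt := (Finset.mem_filter.1 hk).2
      have : i ≠ k := by
        rintro rfl
        omega
      rw [hW i k (by omega), Matrix.one_apply_ne this, zero_mul]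
  · have h2 := hw (i, j)
    dsimp only at h2
    rw [if_neg hij, eq_div_iff (sub_ne_zero.2 (hd i j (by omega)))] at h2
    change ∑ k with β k < β j, w (i, k) * M k j + w (i, j) * d j = d i * w (i, j)
    linear_combination -h2

/-! ### Irreducibility -/

/-- A subspace invariant under generators of the full matrix algebra is trivial. -/
lemma eq_bot_or_eq_top_of_adjoin_eq_top {m : ℕ} {s : Set (Matrix (Fin m) (Fin m) ℂ)}
    (hs : Algebra.adjoin ℂ s = ⊤) (V : Submodule ℂ (Fin m → ℂ))
    (hV : ∀ M ∈ s, ∀ v ∈ V, M.mulVec v ∈ V) : V = ⊥ ∨ V = ⊤ := by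
  have hall : ∀ M : Matrix (Fin m) (Fin m) ℂ, ∀ v ∈ V, M.mulVec v ∈ V := by
    intro M
    have hM : M ∈ Algebra.adjoin ℂ s := hs ▸ Algebra.mem_top
    induction hM using Algebra.adjoin_induction with
    | mem M hM => exact hV M hM
    | algebraMap c =>
      intro v hv
      rw [Algebra.algebraMap_eq_smul_one, Matrix.smul_mulVec, Matrix.one_mulVec]
      exact V.smul_mem c hv
    | add M N _ _ h1 h2 =>
      intro v hv
      rw [Matrix.add_mulVec]
      exact V.add_mem (h1 v hv) (h2 v hv)
    | mul M N _ _ h1 h2 =>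
      intro v hv
      rw [← Matrix.mulVec_mulVec]
      exact h1 _ (h2 v hv)
  by_cases hbot : V = ⊥
  · exact Or.inl hbot
  · right
    obtain ⟨v, hv, hv0⟩ := V.ne_bot_iff.1 hbot
    obtain ⟨i, hi⟩ := Function.ne_iff.1 hv0
    rw [eq_top_iff]
    intro w _
    have h1 := hall (Matrix.vecMulVec w (Pi.single i (v i)⁻¹)) v hv
    rw [Matrix.vecMulVec_mulVec, single_dotProduct, inv_mul_cancel₀ hi] at h1
    simpa using h1

/-- Generating the full matrix algebra is an open condition. -/
lemma eventually_adjoin_eq_top {m : ℕ} {α : Type} {l : Filter α} (Θ S : Matrix (Fin m) (Fin m) ℂ)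
    (M : α → Matrix (Fin m) (Fin m) ℂ) (hM : Tendsto M l (𝓝 S))
    (h : Algebra.adjoin ℂ {Θ, S} = ⊤) : ∀ᶠ ε in l, Algebra.adjoin ℂ {Θ, M ε} = ⊤ := by
  have key : ∀ A : Matrix (Fin m) (Fin m) ℂ, ∃ F : α → Matrix (Fin m) (Fin m) ℂ,
      Tendsto F l (𝓝 A) ∧ ∀ ε, F ε ∈ Algebra.adjoin ℂ {Θ, M ε} := by
    intro A
    have hA : A ∈ Algebra.adjoin ℂ {Θ, S} := h ▸ Algebra.mem_top
    induction hA using Algebra.adjoin_induction with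
    | mem A hA =>
      rcases hA with rfl | hA
      · exact ⟨fun _ => A, tendsto_const_nhds, fun ε => Algebra.subset_adjoin (by simp)⟩
      · rw [Set.mem_singleton_iff] at hA
        subst hA
        exact ⟨M, hM, fun ε => Algebra.subset_adjoin (by simp)⟩
    | algebraMap c =>
      exact ⟨fun _ => algebraMap _ _ c, tendsto_const_nhds, fun ε => Subalgebra.algebraMap_mem _ c⟩
    | add A B _ _ hA hB =>
      obtain ⟨F, hF, hF'⟩ := hA
      obtain ⟨G, hG, hG'⟩ := hB
      exact ⟨fun ε => F ε + G ε, hF.add hG, fun ε => Subalgebra.add_mem _ (hF' ε) (hG' ε)⟩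
    | mul A B _ _ hA hB =>
      obtain ⟨F, hF, hF'⟩ := hA
      obtain ⟨G, hG, hG'⟩ := hB
      exact ⟨fun ε => F ε * G ε, hF.mul hG, fun ε => Subalgebra.mul_mem _ (hF' ε) (hG' ε)⟩
  choose F hF hF' using key
  -- the matrix units deform to a linearly independent family in the algebra
  let E : Fin m × Fin m → (Fin m → Fin m → ℂ) := fun p => Matrix.single p.1 p.2 (1 : ℂ)
  have hE : LinearIndependent ℂ E := by
    have := (Matrix.stdBasis ℂ (Fin m) (Fin m)).linearIndependent
    have h2 : ⇑(Matrix.stdBasis ℂ (Fin m) (Fin m)) = fun p => Matrix.single p.1 p.2 (1 : ℂ) := by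
      funext p
      exact Matrix.stdBasis_eq_single ℂ p.1 p.2
    rw [h2] at this
    exact this
  have hlim : Tendsto (fun (ε : α) (p : Fin m × Fin m) => (F (E p) ε : Fin m → Fin m → ℂ)) l
      (𝓝 E) := tendsto_pi_nhds.2 fun p => hF (E p)
  filter_upwards [hlim.eventually hE.eventually] with ε hε
  have hspan := hε.span_eq_top_of_card_eq_finrank' (by
    rw [Module.finrank_pi_fintype]
    simp)
  rw [eq_top_iff]
  intro A _
  have hle : (⊤ : Submodule ℂ (Fin m → Fin m → ℂ)) ≤
      (Subalgebra.toSubmodule (Algebra.adjoin ℂ {Θ, M ε})).comap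
        (Matrix.ofLinearEquiv ℂ :
          (Fin m → Fin m → ℂ) ≃ₗ[ℂ] Matrix (Fin m) (Fin m) ℂ).toLinearMap := by
    rw [← hspan, Submodule.span_le]
    rintro _ ⟨p, rfl⟩
    exact hF' (E p) ε
  exact hle (x := fun i j => A i j) Submodule.mem_top

/-- The algebra generated by a diagonal matrix contains the functions of this matrix. -/
lemma diagonal_mem_adjoin {m : ℕ} (v f : Fin m → ℂ) (hf : ∀ i j, v i = v j → f i = f j) :
    Matrix.diagonal f ∈ Algebra.adjoin ℂ {Matrix.diagonal v} := by
  classical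
  rcases isEmpty_or_nonempty (Fin m) with hm | hm
  · rw [Subsingleton.elim (Matrix.diagonal f) 0]
    exact Subalgebra.zero_mem _
  let p := Lagrange.interpolate (Finset.univ.image v) id fun c => f (Function.invFun v c)
  have hp : ∀ i, p.eval (v i) = f i := by
    intro i
    have h1 := Lagrange.eval_interpolate_at_node (s := Finset.univ.image v) (v := id)
      (fun c => f (Function.invFun v c)) Function.injective_id.injOn
      (Finset.mem_image_of_mem v (Finset.mem_univ i))
    exact h1.trans (hf _ _ (Function.invFun_eq (f := v) ⟨i, rfl⟩))
  have h2 : Matrix.diagonal f = Polynomial.aeval (Matrix.diagonal v) p := by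
    have h3 := Polynomial.aeval_algHom_apply (Matrix.diagonalAlgHom ℂ (n := Fin m) (α := ℂ)) v p
    rw [Matrix.diagonalAlgHom_apply] at h3
    rw [h3, Matrix.diagonalAlgHom_apply]
    congr 1
    funext i
    rw [← hp i]
    have h4 := Polynomial.aeval_algHom_apply (Pi.evalAlgHom ℂ (fun _ : Fin m => ℂ) i) v p
    rw [Pi.evalAlgHom_apply, Pi.evalAlgHom_apply] at h4
    rw [← h4, Polynomial.coe_aeval_eq_eval]
  rw [h2]
  exact Polynomial.aeval_mem_adjoin_singleton ℂ _

/-- The vector obtained from the basis vector `e_{i₀}` by alternately applying `T` and the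
projections on the level sets of `ρ` that contain the successive entries of a list, read from
the right to the left. -/
def pathVec {m : ℕ} {α : Type} [DecidableEq α] (T : Matrix (Fin m) (Fin m) ℤ) (ρ : Fin m → α)
    (i₀ : Fin m) : List (Fin m) → Fin m → ℤ
  | [] => fun j => if j = i₀ then 1 else 0
  | k :: w => fun j => if ρ j = ρ k then ∑ i, T j i * pathVec T ρ i₀ w i else 0

/-- Certificate that `e_{i₀}` generates the whole space under `T` and the projections on the level
sets of `ρ`: the vector given by the path `w k` is supported in `{k, σ k}`, and it is either
a multiple of `e_k` or, together with the vector of the path `w (σ k)`, a basis of the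
plane spanned by `e_k` and `e_{σ k}`. -/
def Reaches {m : ℕ} {α : Type} [DecidableEq α] (T : Matrix (Fin m) (Fin m) ℤ) (ρ : Fin m → α)
    (i₀ : Fin m) (σ : Fin m → Fin m) (w : Fin m → List (Fin m)) : Prop :=
  ∀ k, (∀ j, j = k ∨ j = σ k ∨ pathVec T ρ i₀ (w k) j = 0) ∧
    (σ k = k ∧ pathVec T ρ i₀ (w k) k ≠ 0 ∨ σ k ≠ k ∧ σ (σ k) = k ∧
      pathVec T ρ i₀ (w k) k * pathVec T ρ i₀ (w (σ k)) (σ k) -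
        pathVec T ρ i₀ (w k) (σ k) * pathVec T ρ i₀ (w (σ k)) k ≠ 0)

instance {m : ℕ} {α : Type} [DecidableEq α] (T : Matrix (Fin m) (Fin m) ℤ) (ρ : Fin m → α)
    (i₀ : Fin m) (σ : Fin m → Fin m) (w : Fin m → List (Fin m)) :
    Decidable (Reaches T ρ i₀ σ w) :=
  inferInstanceAs (Decidable (∀ _, _))

lemma Reaches.eq_top {m : ℕ} {α : Type} [DecidableEq α] {T : Matrix (Fin m) (Fin m) ℤ}
    {ρ : Fin m → α} {i₀ : Fin m} {σ : Fin m → Fin m} {w : Fin m → List (Fin m)}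
    (h : Reaches T ρ i₀ σ w) (V : Submodule ℂ (Fin m → ℂ))
    (hT : ∀ v ∈ V, (T.map (Int.cast : ℤ → ℂ)).mulVec v ∈ V)
    (hρ : ∀ k, ∀ v ∈ V, (fun j => if ρ j = ρ k then v j else 0) ∈ V)
    (h0 : Pi.single i₀ 1 ∈ V) : V = ⊤ := by
  have hpath : ∀ w : List (Fin m), (fun j => (pathVec T ρ i₀ w j : ℂ)) ∈ V := by
    intro w
    induction w with
    | nil =>
      have : (fun j => (pathVec T ρ i₀ [] j : ℂ)) = Pi.single i₀ 1 := by
        funext j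
        simp [pathVec, Pi.single_apply]
      rw [this]
      exact h0
    | cons k w ih =>
      have : (fun j => (pathVec T ρ i₀ (k :: w) j : ℂ)) = fun j => if ρ j = ρ k then
          (T.map (Int.cast : ℤ → ℂ)).mulVec (fun i => (pathVec T ρ i₀ w i : ℂ)) j else 0 := by
        funext j
        simp only [pathVec, Matrix.mulVec, dotProduct, Matrix.map_apply]
        split_ifs
        · push_cast
          rfl
        · simp
      rw [this]
      exact hρ k _ (hT _ ih)
  have hsingle : ∀ k, (Pi.single k 1 : Fin m → ℂ) ∈ V := by
    intro k
    obtain ⟨hs, ⟨hk, hne⟩ | ⟨hk, hkk, hne⟩⟩ := h k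
    · have h1 := V.smul_mem ((pathVec T ρ i₀ (w k) k : ℂ)⁻¹) (hpath (w k))
      convert h1 using 1
      funext j
      rw [Pi.smul_apply, smul_eq_mul]
      by_cases hj : j = k
      · subst hj
        rw [Pi.single_eq_same, inv_mul_cancel₀ (by exact_mod_cast hne)]
      · have h2 : pathVec T ρ i₀ (w k) j = 0 := by
          rcases hs j with h3 | h3 | h3
          · exact absurd h3 hj
          · exact absurd (h3.trans hk) hj
          · exact h3
        rw [Pi.single_eq_of_ne hj, h2, Int.cast_zero, mul_zero]
    · have h1 := V.smul_mem (((pathVec T ρ i₀ (w k) k * pathVec T ρ i₀ (w (σ k)) (σ k) -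
        pathVec T ρ i₀ (w k) (σ k) * pathVec T ρ i₀ (w (σ k)) k : ℤ) : ℂ)⁻¹)
        (V.sub_mem (V.smul_mem (pathVec T ρ i₀ (w (σ k)) (σ k) : ℂ) (hpath (w k)))
          (V.smul_mem (pathVec T ρ i₀ (w k) (σ k) : ℂ) (hpath (w (σ k)))))
      convert h1 using 1
      funext j
      rw [Pi.smul_apply, Pi.sub_apply, Pi.smul_apply, Pi.smul_apply, smul_eq_mul, smul_eq_mul,
        smul_eq_mul]
      by_cases hj : j = k
      · subst hj
        rw [Pi.single_eq_same, eq_comm, inv_mul_eq_one₀ (by exact_mod_cast hne)]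
        push_cast
        ring
      · rw [Pi.single_eq_of_ne hj]
        by_cases hj' : j = σ k
        · subst hj'
          ring
        · have h2 : pathVec T ρ i₀ (w k) j = 0 := by
            rcases hs j with h3 | h3 | h3
            · exact absurd h3 hj
            · exact absurd h3 hj'
            · exact h3
          have h4 : pathVec T ρ i₀ (w (σ k)) j = 0 := by
            rcases (h (σ k)).1 j with h3 | h3 | h3
            · exact absurd h3 hj'
            · exact absurd (h3.trans hkk) hj
            · exact h3
          rw [h2, h4, Int.cast_zero, mul_zero, mul_zero, sub_zero, mul_zero]
  rw [eq_top_iff]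
  intro v _
  rw [pi_eq_sum_univ' v]
  refine V.sum_mem fun k _ => V.smul_mem _ ?_
  convert hsingle k using 1

/-- An algebra of matrices which contains `T` and the projections on the level sets of `ρ`, one of
which is a line `ℂ e_{i₀}`, is the full matrix algebra as soon as `e_{i₀}` generates the space of
columns and the space of rows. -/
lemma eq_top_of_reaches {m : ℕ} {α : Type} [DecidableEq α] {T : Matrix (Fin m) (Fin m) ℤ}
    {ρ : Fin m → α} {i₀ : Fin m} {σ : Fin m → Fin m} {w w' : Fin m → List (Fin m)}
    (h : Reaches T ρ i₀ σ w) (h' : Reaches T.transpose ρ i₀ σ w') (hi₀ : ∀ j, ρ j = ρ i₀ → j = i₀)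
    (𝒜 : Subalgebra ℂ (Matrix (Fin m) (Fin m) ℂ)) (hT : T.map (Int.cast : ℤ → ℂ) ∈ 𝒜)
    (hρ : ∀ k, Matrix.diagonal (fun j => if ρ j = ρ k then (1 : ℂ) else 0) ∈ 𝒜) : 𝒜 = ⊤ := by
  have hproj : ∀ (k : Fin m) (v : Fin m → ℂ),
      (Matrix.diagonal (fun j => if ρ j = ρ k then (1 : ℂ) else 0)).mulVec v =
        fun j => if ρ j = ρ k then v j else 0 := by
    intro k v
    funext j
    rw [Matrix.mulVec_diagonal]
    split_ifs <;> simp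
  have hproj' : ∀ (k : Fin m) (v : Fin m → ℂ),
      Matrix.vecMul v (Matrix.diagonal (fun j => if ρ j = ρ k then (1 : ℂ) else 0)) =
        fun j => if ρ j = ρ k then v j else 0 := by
    intro k v
    funext j
    rw [Matrix.vecMul_diagonal]
    split_ifs <;> simp
  have hcol : ∀ v : Fin m → ℂ, ∃ a ∈ 𝒜, a.mulVec (Pi.single i₀ 1) = v := by
    let V : Submodule ℂ (Fin m → ℂ) :=
      { carrier := {v | ∃ a ∈ 𝒜, a.mulVec (Pi.single i₀ 1) = v}
        add_mem' := by
          rintro _ _ ⟨a, ha, rfl⟩ ⟨b, hb, rfl⟩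
          exact ⟨a + b, 𝒜.add_mem ha hb, Matrix.add_mulVec _ _ _⟩
        zero_mem' := ⟨0, 𝒜.zero_mem, Matrix.zero_mulVec _⟩
        smul_mem' := by
          rintro c _ ⟨a, ha, rfl⟩
          exact ⟨c • a, 𝒜.smul_mem ha c, Matrix.smul_mulVec _ _ _⟩ }
    have hV : V = ⊤ := by
      refine h.eq_top V ?_ ?_ ⟨1, 𝒜.one_mem, Matrix.one_mulVec _⟩
      · rintro _ ⟨a, ha, rfl⟩
        exact ⟨_, 𝒜.mul_mem hT ha, (Matrix.mulVec_mulVec _ _ _).symm⟩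
      · rintro k _ ⟨a, ha, rfl⟩
        exact ⟨_, 𝒜.mul_mem (hρ k) ha, (Matrix.mulVec_mulVec _ _ _).symm.trans (hproj k _)⟩
    intro v
    have : v ∈ V := hV ▸ Submodule.mem_top
    exact this
  have hrow : ∀ v : Fin m → ℂ, ∃ a ∈ 𝒜, Matrix.vecMul (Pi.single i₀ 1) a = v := by
    let V : Submodule ℂ (Fin m → ℂ) :=
      { carrier := {v | ∃ a ∈ 𝒜, Matrix.vecMul (Pi.single i₀ 1) a = v}
        add_mem' := by
          rintro _ _ ⟨a, ha, rfl⟩ ⟨b, hb, rfl⟩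
          exact ⟨a + b, 𝒜.add_mem ha hb, Matrix.vecMul_add _ _ _⟩
        zero_mem' := ⟨0, 𝒜.zero_mem, Matrix.vecMul_zero _⟩
        smul_mem' := by
          rintro c _ ⟨a, ha, rfl⟩
          exact ⟨c • a, 𝒜.smul_mem ha c, Matrix.vecMul_smul _ _ _⟩ }
    have hV : V = ⊤ := by
      refine h'.eq_top V ?_ ?_ ⟨1, 𝒜.one_mem, Matrix.vecMul_one _⟩
      · rintro _ ⟨a, ha, rfl⟩
        refine ⟨_, 𝒜.mul_mem ha hT, ?_⟩
        rw [Matrix.transpose_map, Matrix.mulVec_transpose, Matrix.vecMul_vecMul]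
      · rintro k _ ⟨a, ha, rfl⟩
        exact ⟨_, 𝒜.mul_mem ha (hρ k), (Matrix.vecMul_vecMul _ _ _).symm.trans (hproj' k _)⟩
    intro v
    have : v ∈ V := hV ▸ Submodule.mem_top
    exact this
  have hunit : ∀ i j, Matrix.single i j (1 : ℂ) ∈ 𝒜 := by
    intro i j
    obtain ⟨a, ha, ha'⟩ := hcol (Pi.single i 1)
    obtain ⟨b, hb, hb'⟩ := hrow (Pi.single j 1)
    have h1 : Matrix.single i j (1 : ℂ) =
        a * Matrix.diagonal (fun j => if ρ j = ρ i₀ then (1 : ℂ) else 0) * b := by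
      ext1 x y
      rw [Matrix.mul_apply, Finset.sum_eq_single i₀]
      · have h2 := congrFun ha' x
        have h3 := congrFun hb' y
        rw [Matrix.mulVec_single_one] at h2
        rw [Matrix.single_one_vecMul] at h3
        change a x i₀ = _ at h2
        change b i₀ y = _ at h3
        rw [Matrix.mul_diagonal, if_pos rfl, mul_one, h2, h3, Matrix.single_apply, Pi.single_apply,
          Pi.single_apply, ite_and]
        by_cases hx : i = x
        · subst hx
          by_cases hy : j = y
          · subst hy; simp
          · simp [hy, Ne.symm hy]
        · simp [hx, Ne.symm hx]
      · intro k _ hk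
        rw [Matrix.mul_diagonal, if_neg fun h4 => hk (hi₀ k h4), mul_zero, zero_mul]
      · simp
    rw [h1]
    exact 𝒜.mul_mem (𝒜.mul_mem ha (hρ i₀)) hb
  rw [eq_top_iff]
  intro A _
  rw [Matrix.matrix_eq_sum_single A]
  refine 𝒜.sum_mem fun i _ => 𝒜.sum_mem fun j _ => ?_
  have h1 : Matrix.single i j (A i j) = A i j • Matrix.single i j (1 : ℂ) := by
    rw [Matrix.smul_single, smul_eq_mul, mul_one]
  rw [h1]
  exact 𝒜.smul_mem (hunit i j) _

/-! ### Pairs of matrices and the systems attached to them -/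

/-- An integral solution of the additive problem behind an arrow. The rows and columns of size `m`
are cut into blocks by `β`, and `N` is a common denominator; with `Θ = Q P / N` and
`S = diag (i β)`, the system `dY/dx = (Θ / x + S) Y` is a limit of Fuchsian systems, and its
Laplace transform is the Fuchsian system of size `r` with residues `-P_k Q_k / N` at the points
`i k`. -/
structure Datum (m r K : ℕ) where
  /-- the factor `P` of `Θ` -/
  P : Matrix (Fin r) (Fin m) ℤ
  /-- the factor `Q` of `Θ` -/
  Q : Matrix (Fin m) (Fin r) ℤ
  /-- the common denominator -/
  N : ℕ
  /-- the partition of the indices into blocks -/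
  β : Fin m → Fin K
  /-- the diagonal blocks of `Q P` -/
  D : Fin m → ℤ
  /-- the eigenvalues of `P Q` -/
  Δ : Fin r → ℤ

/-- The conditions on a datum: `P Q` and the diagonal blocks of `Q P` are diagonal and invertible,
their eigenvalues are small in comparison with `N`, and `Q P` together with the projections on the
blocks generates the full matrix algebra. -/
structure Datum.Valid {m r K : ℕ} (X : Datum m r K) : Prop where
  r_pos : 0 < r
  r_le : r ≤ m
  card_le : ∀ k, Fintype.card {i // X.β i = k} ≤ r
  surj : ∀ k, ∃ i, X.β i = k
  nontrivial : ∃ i, (X.β i : ℕ) ≠ 0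
  PQ : X.P * X.Q = Matrix.diagonal X.Δ
  QP : ∀ i j, X.β i = X.β j → (X.Q * X.P) i j = if i = j then X.D i else 0
  D_ne : ∀ i, X.D i ≠ 0
  Δ_ne : ∀ j, X.Δ j ≠ 0
  D_lt : ∀ i, 2 * |X.D i| < X.N
  Δ_lt : ∀ j, 2 * |X.Δ j| < X.N
  reaches : ∃ (i₀ : Fin m) (σ : Fin m → Fin m) (w w' : Fin m → List (Fin m)),
    (∀ j, (X.β j, X.D j) = (X.β i₀, X.D i₀) → j = i₀) ∧
    Reaches (X.Q * X.P) (fun i => (X.β i, X.D i)) i₀ σ w ∧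
    Reaches (X.Q * X.P).transpose (fun i => (X.β i, X.D i)) i₀ σ w'

namespace Datum
variable {m r K : ℕ} (X : Datum m r K)

/-- The matrix `P / N`. -/
noncomputable def Pc : Matrix (Fin r) (Fin m) ℂ := Matrix.of fun i j => (X.P i j : ℂ) / X.N

/-- The matrix `Q` with complex entries. -/
noncomputable def Qc : Matrix (Fin m) (Fin r) ℂ := X.Q.map (Int.cast : ℤ → ℂ)

/-- The residue `Θ = Q P / N` at the origin. -/
noncomputable def Θ : Matrix (Fin m) (Fin m) ℂ := X.Qc * X.Pc

/-- The points `i k`, whose differences are never non-zero integers. -/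
noncomputable def pole (k : Fin K) : ℂ := (k : ℕ) * Complex.I

/-- The diagonal matrix `S = diag (i β)`, scalar on each block. -/
noncomputable def S : Matrix (Fin m) (Fin m) ℂ := Matrix.diagonal fun i => pole (X.β i)

/-- The part of `Θ` strictly below the diagonal blocks. -/
noncomputable def L : Matrix (Fin m) (Fin m) ℂ :=
  Matrix.of fun i j => if X.β j < X.β i then X.Θ i j else 0

lemma pole_re (k : Fin K) : (pole k).re = 0 := by simp [pole]

lemma pole_im (k : Fin K) : (pole k).im = (k : ℕ) := by simp [pole]

lemma pole_injective : Function.Injective (pole : Fin K → ℂ) := by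
  intro k l h
  have := congrArg Complex.im h
  rw [pole_im, pole_im] at this
  exact Fin.ext (by exact_mod_cast this)

lemma Θ_apply (i j : Fin m) : X.Θ i j = ((X.Q * X.P) i j : ℂ) / X.N := by
  rw [Θ, Matrix.mul_apply, Matrix.mul_apply]
  push_cast
  rw [Finset.sum_div]
  refine Finset.sum_congr rfl fun l _ => ?_
  simp [Qc, Pc, mul_div_assoc]

variable {X} (h : X.Valid)
include h

lemma N_pos : 0 < X.N := by
  have h1 := h.Δ_lt ⟨0, h.r_pos⟩
  have h2 := abs_nonneg (X.Δ ⟨0, h.r_pos⟩)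
  omega

lemma N_ne : (X.N : ℂ) ≠ 0 := Nat.cast_ne_zero.2 (N_pos h).ne'

lemma div_N_inj {x y : ℤ} : (x : ℂ) / X.N = (y : ℂ) / X.N ↔ x = y := by
  rw [div_left_inj' (N_ne h), Int.cast_inj]

lemma nonresonant {x y n : ℤ} (hx : 2 * |x| < X.N) (hy : 2 * |y| < X.N)
    (hn : (x : ℂ) / X.N - (y : ℂ) / X.N = n) : n = 0 := by
  rw [← sub_div, div_eq_iff (N_ne h)] at hn
  have h1 : x - y = n * X.N := by exact_mod_cast hn
  have h2 : |x - y| < X.N := by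
    have := abs_sub x y
    omega
  rw [h1, abs_mul, Nat.abs_cast] at h2
  have h3 : |n| < 1 := by
    by_contra hcon
    have : (X.N : ℤ) ≤ |n| * X.N := le_mul_of_one_le_left (by positivity) (not_lt.1 hcon)
    omega
  exact Int.abs_lt_one_iff.1 h3

lemma Θ_diagBlock {i j : Fin m} (hij : X.β i = X.β j) :
    X.Θ i j = Matrix.diagonal (fun i => (X.D i : ℂ) / X.N) i j := by
  rw [Θ_apply, h.QP i j hij]
  by_cases h1 : i = j
  · subst h1; simp
  · simp [h1]

lemma Pc_mul_Qc : X.Pc * X.Qc = Matrix.diagonal fun j => (X.Δ j : ℂ) / X.N := by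
  ext1 i j
  have h1 := congrFun (congrFun h.PQ i) j
  rw [Matrix.mul_apply] at h1 ⊢
  have h2 : ∑ l, X.Pc i l * X.Qc l j = ((∑ l, X.P i l * X.Q l j : ℤ) : ℂ) / X.N := by
    push_cast
    rw [Finset.sum_div]
    refine Finset.sum_congr rfl fun l _ => ?_
    simp [Qc, Pc]
    ring
  rw [h2, h1]
  by_cases h3 : i = j
  · subst h3; simp
  · simp [h3]

/-- The algebra generated by `Θ` and `S` contains the projections on the blocks, hence the block
diagonal part of `Θ`, and the projections on the joint level sets of `β` and `D`. -/
lemma adjoin_eq_top : Algebra.adjoin ℂ {X.Θ, X.S} = ⊤ := by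
  obtain ⟨i₀, σ, w, w', hi₀, hw, hw'⟩ := h.reaches
  set 𝒜 := Algebra.adjoin ℂ {X.Θ, X.S} with h𝒜
  have hΘ : X.Θ ∈ 𝒜 := Algebra.subset_adjoin (by simp)
  have hS : ∀ f : Fin m → ℂ, (∀ i j, X.β i = X.β j → f i = f j) → Matrix.diagonal f ∈ 𝒜 := by
    intro f hf
    have h1 := diagonal_mem_adjoin (fun i => pole (X.β i)) f fun i j hij =>
      hf i j (pole_injective hij)
    exact Algebra.adjoin_mono (by
      rw [Set.singleton_subset_iff]
      exact Set.mem_insert_of_mem _ rfl) h1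
  -- the block diagonal part of `Θ`
  have hD : Matrix.diagonal (fun i => (X.D i : ℂ) / X.N) ∈ 𝒜 := by
    have h1 : Matrix.diagonal (fun i => (X.D i : ℂ) / X.N) =
        ∑ k, Matrix.diagonal (fun i => if X.β i = k then (1 : ℂ) else 0) * X.Θ *
          Matrix.diagonal (fun i => if X.β i = k then (1 : ℂ) else 0) := by
      ext1 i j
      rw [Matrix.sum_apply, Finset.sum_eq_single (X.β i)]
      · rw [Matrix.mul_diagonal, Matrix.diagonal_mul, if_pos rfl, one_mul]
        by_cases hij : X.β j = X.β i
        · rw [if_pos hij, mul_one, Θ_diagBlock h hij.symm]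
        · rw [if_neg hij, mul_zero, Matrix.diagonal_apply_ne]
          rintro rfl
          exact hij rfl
      · intro k _ hk
        rw [Matrix.mul_diagonal, Matrix.diagonal_mul, if_neg (Ne.symm hk), zero_mul, zero_mul]
      · simp
    rw [h1]
    refine 𝒜.sum_mem fun k _ => 𝒜.mul_mem (𝒜.mul_mem (hS _ ?_) hΘ) (hS _ ?_)
    · intro i j hij
      rw [hij]
    · intro i j hij
      rw [hij]
  have hρ : ∀ f : Fin m → ℂ, (∀ i j, (X.β i, X.D i) = (X.β j, X.D j) → f i = f j) →
      Matrix.diagonal f ∈ 𝒜 := by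
    intro f hf
    have h1 := diagonal_mem_adjoin (fun i => (X.D i : ℂ) / X.N + pole (X.β i)) f (by
      intro i j hij
      apply hf
      have him := congrArg Complex.im hij
      have hre : ∀ i, ((X.D i : ℂ) / X.N).im = 0 := by
        intro i
        have : (X.D i : ℂ) / X.N = (((X.D i : ℝ) / X.N : ℝ) : ℂ) := by push_cast; rfl
        rw [this, Complex.ofReal_im]
      rw [Complex.add_im, Complex.add_im, pole_im, pole_im, hre, hre, zero_add, zero_add] at him
      have hβ : X.β i = X.β j := Fin.ext (by exact_mod_cast him)
      rw [hβ, add_left_inj, div_N_inj h] at hij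
      rw [hβ, hij])
    have h2 : Matrix.diagonal (fun i => (X.D i : ℂ) / X.N + pole (X.β i)) ∈ 𝒜 := by
      rw [← Matrix.diagonal_add]
      exact 𝒜.add_mem hD (Algebra.subset_adjoin (Set.mem_insert_of_mem _ rfl))
    exact Algebra.adjoin_le (Set.singleton_subset_iff.2 h2) h1
  refine eq_top_of_reaches hw hw' hi₀ 𝒜 ?_ fun k => hρ _ ?_
  · have h1 : (X.Q * X.P).map (Int.cast : ℤ → ℂ) = (X.N : ℂ) • X.Θ := by
      ext1 i j
      rw [Matrix.smul_apply, Θ_apply, smul_eq_mul, mul_div_cancel₀ _ (N_ne h), Matrix.map_apply]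
    rw [h1]
    exact 𝒜.smul_mem hΘ _
  · intro i j hij
    rw [hij]

omit h

variable (X)

/-- The Fuchsian system `Θ / x - (S / ε + L) / (x - 1 / ε)`. Its residue at infinity is
`S / ε + L - Θ`, so that the residues at `1 / ε` and at infinity are block triangular. -/
noncomputable def family (ε : ℝ) : Matrix (Fin m) (Fin m) (RatFunc ℂ) :=
  pfrac (![0, (ε : ℂ)⁻¹] : Fin 2 → ℂ) ![X.Θ, -((ε : ℂ)⁻¹ • X.S + X.L)] 0

/-- The coefficient matrix of the limit `Θ / x + S`. -/
noncomputable def limitCoeff : Matrix (Fin m) (Fin m) (RatFunc ℂ) :=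
  pfrac (fun _ : Unit => (0 : ℂ)) (fun _ => X.Θ) X.S

/-- The coefficient matrix of the Laplace transform of the limit. -/
noncomputable def laplaceCoeff : Matrix (Fin r) (Fin r) (RatFunc ℂ) :=
  pfrac (pole : Fin K → ℂ) (fun k => -Matrix.of fun i j =>
    ∑ l with X.β l = k, X.Pc i l * X.Qc l j) 0

variable {X}

lemma isNonsingularAt_family {ε : ℝ} {p : OnePoint ℂ}
    (h0 : p ≠ ((0 : ℂ) : OnePoint ℂ)) (h1 : p ≠ (((ε : ℂ)⁻¹ : ℂ) : OnePoint ℂ))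
    (h2 : p ≠ OnePoint.infty) : IsNonsingularAt (X.family ε) p := by
  induction p using OnePoint.rec with
  | infty => exact absurd rfl h2
  | coe p =>
    refine pfrac_isNonsingularAt _ _ _ fun k => ?_
    fin_cases k
    · exact fun h => h0 (congrArg _ h)
    · exact fun h => h1 (congrArg _ h)

lemma family_poles_injective {ε : ℝ} (hε : 0 < ε) :
    Function.Injective (![0, (ε : ℂ)⁻¹] : Fin 2 → ℂ) := by
  have h0 : (ε : ℂ)⁻¹ ≠ 0 := inv_ne_zero (Complex.ofReal_ne_zero.2 hε.ne')
  intro i j hij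
  fin_cases i <;> fin_cases j
  · rfl
  · exact absurd hij.symm h0
  · exact absurd hij h0
  · rfl

include h

lemma Θ_diagonalizable : ∃ d : Fin m → ℂ, DiagonalizableTo X.Θ d ∧ d ≠ 0 ∧
    (∀ (i j : Fin m) (n : ℤ), d i - d j = (n : ℂ) → n = 0) ∧
    mults d = mults (Sum.elim X.Δ (fun _ => 0) : Fin r ⊕ Fin (m - r) → ℤ) := by
  obtain ⟨e, he⟩ := diagonalizableTo_of_mul (c := m - r) X.Qc X.Pc
    (fun j => (X.Δ j : ℂ) / X.N)
    (fun j => div_ne_zero (Int.cast_ne_zero.2 (h.Δ_ne j)) (N_ne h)) (Pc_mul_Qc h) (by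
      rw [Fintype.card_fin]
      have := h.r_le
      omega)
  let f : Fin r ⊕ Fin (m - r) → ℤ := Sum.elim X.Δ (fun _ => 0)
  have hf : ∀ x, (Sum.elim (fun j => (X.Δ j : ℂ) / X.N) 0 : Fin r ⊕ Fin (m - r) → ℂ) x =
      (f x : ℂ) / X.N := by
    rintro (j | j) <;> simp [f]
  have hlt : ∀ x, 2 * |f x| < X.N := by
    rintro (j | j)
    · exact h.Δ_lt j
    · have := N_pos h
      simpa [f] using this
  refine ⟨_, he, ?_, ?_, ?_⟩
  · intro h0
    have h1 := congrFun h0 (e (Sum.inl ⟨0, h.r_pos⟩))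
    rw [Function.comp_apply, Equiv.symm_apply_apply, hf] at h1
    exact div_ne_zero (Int.cast_ne_zero.2 (h.Δ_ne _)) (N_ne h) h1
  · intro i j n hn
    rw [Function.comp_apply, Function.comp_apply, hf, hf] at hn
    exact nonresonant h (hlt _) (hlt _) hn
  · rw [mults_comp_equiv]
    refine mults_of_iff _ _ fun x y => ?_
    rw [hf, hf, div_N_inj h]

lemma hasLocalType_zero_family {ε : ℝ} (hε : 0 < ε) :
    HasLocalType (X.family ε) ((0 : ℂ) : OnePoint ℂ)
      (regularType (mults (Sum.elim X.Δ (fun _ => 0) : Fin r ⊕ Fin (m - r) → ℤ))) := by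
  obtain ⟨d, hd, hd0, hres, hm⟩ := Θ_diagonalizable h
  have hinj := family_poles_injective hε
  exact (pfrac_hasSimplePole _ _ _ hinj 0).hasLocalType hd hd0 hres hm

lemma hasLocalType_inv_family {ε : ℝ} (hε : 0 < ε) :
    HasLocalType (X.family ε) (((ε : ℂ)⁻¹ : ℂ) : OnePoint ℂ) (regularType (mults X.β)) := by
  have hε' : (ε : ℂ)⁻¹ ≠ 0 := inv_ne_zero (Complex.ofReal_ne_zero.2 hε.ne')
  have hinj := family_poles_injective hε
  have hiff : ∀ i j, -((ε : ℂ)⁻¹ * pole (X.β i)) = -((ε : ℂ)⁻¹ * pole (X.β j)) ↔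
      X.β i = X.β j := by
    intro i j
    rw [neg_inj, mul_right_inj' hε', pole_injective.eq_iff]
  have hd : DiagonalizableTo (-((ε : ℂ)⁻¹ • X.S + X.L))
      fun i => -((ε : ℂ)⁻¹ * pole (X.β i)) := by
    -- the matrix is block lower triangular, hence the reversed order of the blocks
    refine diagonalizableTo_of_blockTriangular _ (fun i => K - (X.β i : ℕ)) _ ?_ ?_ ?_
    · intro i
      simp [S, L]
    · intro i j hij hne
      have h1 : ¬ X.β j < X.β i := by
        intro h2
        have h3 : (X.β j : ℕ) < X.β i := h2
        have h4 := (X.β i).2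
        omega
      simp [S, L, hne, h1]
    · intro i j hij heq
      rw [hiff] at heq
      exact hij (by rw [heq])
  refine (pfrac_hasSimplePole _ _ _ hinj 1).hasLocalType hd ?_ ?_ (mults_of_iff _ _ hiff)
  · obtain ⟨i, hi⟩ := h.nontrivial
    intro h0
    have h1 := congrFun h0 i
    rw [Pi.zero_apply, neg_eq_zero, mul_eq_zero] at h1
    have h2 := congrArg Complex.im (h1.resolve_left hε')
    rw [pole_im, Complex.zero_im] at h2
    exact hi (by exact_mod_cast h2)
  · intro i j n hn
    have h1 := congrArg Complex.re hn
    rw [← Complex.ofReal_inv, Complex.sub_re, Complex.neg_re, Complex.neg_re,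
      Complex.re_ofReal_mul, Complex.re_ofReal_mul, pole_re, pole_re, Complex.intCast_re] at h1
    have h2 : (n : ℝ) = 0 := by linarith
    exact_mod_cast h2

lemma hasLocalType_infty_family {ε : ℝ} (hε : 0 < ε) :
    HasLocalType (X.family ε) OnePoint.infty
      (regularType (mults fun i => (X.β i, X.D i))) := by
  have hre : ∀ x : ℤ, (x : ℂ) / X.N = (((x : ℝ) / X.N : ℝ) : ℂ) := by
    intro x; push_cast; rfl
  let d : Fin m → ℂ := fun i => (ε : ℂ)⁻¹ * pole (X.β i) - (X.D i : ℂ) / X.N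
  have him : ∀ i, (d i).im = ε⁻¹ * (X.β i : ℕ) := by
    intro i
    simp only [d]
    rw [hre, ← Complex.ofReal_inv, Complex.sub_im, Complex.im_ofReal_mul, pole_im,
      Complex.ofReal_im, sub_zero]
  have hβ : ∀ i j, (d i).im = (d j).im → X.β i = X.β j := by
    intro i j hij
    rw [him, him, mul_right_inj' (inv_ne_zero hε.ne')] at hij
    exact Fin.ext (by exact_mod_cast hij)
  have hd : DiagonalizableTo (-∑ k, (![X.Θ, -((ε : ℂ)⁻¹ • X.S + X.L)] :
      Fin 2 → Matrix (Fin m) (Fin m) ℂ) k) d := by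
    have hsum : (-∑ k, (![X.Θ, -((ε : ℂ)⁻¹ • X.S + X.L)] :
        Fin 2 → Matrix (Fin m) (Fin m) ℂ) k) = (ε : ℂ)⁻¹ • X.S + X.L - X.Θ := by
      rw [Fin.sum_univ_two]
      simp only [Matrix.cons_val_zero, Matrix.cons_val_one]
      abel
    rw [hsum]
    refine diagonalizableTo_of_blockTriangular _ (fun i => (X.β i : ℕ)) _ ?_ ?_ ?_
    · intro i
      rw [Matrix.sub_apply, Θ_diagBlock h rfl]
      simp [S, L, d]
    · intro i j hij hne
      rw [Matrix.sub_apply, Matrix.add_apply, Matrix.smul_apply, S, Matrix.diagonal_apply_ne _ hne,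
        smul_zero, zero_add, L, Matrix.of_apply]
      split_ifs with h1
      · exact sub_self _
      · have h2 : X.β i = X.β j := by
          have h3 : ¬ (X.β j : ℕ) < X.β i := h1
          exact Fin.ext (by omega)
        rw [Θ_diagBlock h h2, Matrix.diagonal_apply_ne _ hne, sub_zero]
    · intro i j hij heq
      exact hij (congrArg _ (hβ i j (congrArg _ heq)))
  refine (pfrac_hasSimplePole_infty _ _).hasLocalType hd ?_ ?_ ?_
  · intro h0
    obtain ⟨i, -⟩ := h.nontrivial
    have h1 := congrArg Complex.re (congrFun h0 i)
    simp only [d] at h1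
    rw [← Complex.ofReal_inv, Complex.sub_re, Complex.re_ofReal_mul, pole_re, mul_zero, zero_sub,
      Pi.zero_apply, Complex.zero_re, hre, Complex.ofReal_re, neg_eq_zero, div_eq_zero_iff] at h1
    rcases h1 with h1 | h1
    · exact h.D_ne i (by exact_mod_cast h1)
    · exact (N_pos h).ne' (by exact_mod_cast h1)
  · intro i j n hn
    have h1 := congrArg Complex.im hn
    rw [Complex.sub_im, Complex.intCast_im, sub_eq_zero] at h1
    have h2 := hβ i j h1
    simp only [d] at hn
    rw [h2] at hn
    exact nonresonant h (h.D_lt j) (h.D_lt i) (by linear_combination hn)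
  · refine mults_of_iff _ _ fun i j => ⟨fun hij => ?_, fun hij => ?_⟩
    · have h2 := hβ i j (congrArg _ hij)
      simp only [d] at hij
      rw [h2, sub_right_inj, div_N_inj h] at hij
      rw [h2, hij]
    · have h2 := Prod.ext_iff.1 hij
      simp only at h2
      simp only [d, h2.1, h2.2]

lemma irreducible_family :
    ∀ᶠ ε in 𝓝[>] (0 : ℝ), LinSystem.Irreducible ⟨m, X.family ε⟩ := by
  have hlim : Tendsto (fun ε : ℝ => X.S + (ε : ℂ) • X.L) (𝓝[>] 0) (𝓝 X.S) := by
    have hcont : Continuous fun ε : ℝ => X.S + (ε : ℂ) • X.L :=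
      continuous_const.add (Complex.continuous_ofReal.smul continuous_const)
    have h0 := hcont.tendsto 0
    simp only [Complex.ofReal_zero, zero_smul, add_zero] at h0
    exact h0.mono_left nhdsWithin_le_nhds
  filter_upwards [eventually_adjoin_eq_top _ _ _ hlim (adjoin_eq_top h), self_mem_nhdsWithin]
    with ε htop hε
  have hε' : (ε : ℂ) ≠ 0 := Complex.ofReal_ne_zero.2 (ne_of_gt hε)
  have hinj := family_poles_injective hε
  refine ⟨h.r_pos.trans_le h.r_le, fun V hV => eq_bot_or_eq_top_of_adjoin_eq_top htop V ?_⟩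
  have hres := mem_of_pfrac_invariant hinj _ _ V hV
  intro M hM v hv
  rcases hM with rfl | hM
  · exact hres 0 v hv
  · rw [Set.mem_singleton_iff] at hM
    subst hM
    have h1 := V.smul_mem (-(ε : ℂ)) (hres 1 v hv)
    rw [← Matrix.smul_mulVec] at h1
    have h2 : -(ε : ℂ) • -((ε : ℂ)⁻¹ • X.S + X.L) = X.S + (ε : ℂ) • X.L := by
      rw [neg_smul, smul_neg, neg_neg, smul_add, smul_smul, mul_inv_cancel₀ hε', one_smul]
    rw [← h2]
    exact h1

lemma irreducible_limitCoeff : LinSystem.Irreducible ⟨m, X.limitCoeff⟩ := by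
  refine ⟨h.r_pos.trans_le h.r_le, fun V hV =>
    eq_bot_or_eq_top_of_adjoin_eq_top (adjoin_eq_top h) V ?_⟩
  have hΘ : ∀ v ∈ V, X.Θ.mulVec v ∈ V :=
    mem_of_pfrac_invariant (Function.injective_of_subsingleton _) _ _ V hV ()
  intro M hM v hv
  rcases hM with rfl | hM
  · exact hΘ v hv
  · rw [Set.mem_singleton_iff] at hM
    subst hM
    have hx : ∀ k : Unit, (1 : ℂ) ≠ (fun _ : Unit => (0 : ℂ)) k := fun _ => one_ne_zero
    have h1 := hV 1 (fun i j => (hasValue_pfrac _ _ _ hx i j).1) v hv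
    have h2 : evalAt X.limitCoeff 1 = X.Θ + X.S := by
      rw [limitCoeff, evalAt_pfrac _ _ _ hx]
      simp
    change (evalAt X.limitCoeff 1).mulVec v ∈ V at h1
    rw [h2, Matrix.add_mulVec] at h1
    exact (V.add_mem_iff_right (hΘ v hv)).1 h1

/-- A subspace `W` invariant under the residues `P_k Q_k` of the Laplace transform is trivial: the
vectors `v` with `P_k v_k ∈ W` for all `k` form a subspace invariant under `Θ` and `S`. -/
lemma irreducible_laplaceCoeff : LinSystem.Irreducible ⟨r, X.laplaceCoeff⟩ := by
  refine ⟨h.r_pos, fun W hW => ?_⟩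
  have hres := mem_of_pfrac_invariant pole_injective _ _ W hW
  let π : Fin K → Matrix (Fin m) (Fin m) ℂ := fun k =>
    Matrix.diagonal fun i => if X.β i = k then 1 else 0
  have hR : ∀ k, ∀ w ∈ W, (X.Pc * π k * X.Qc).mulVec w ∈ W := by
    intro k w hw
    have h1 := W.neg_mem (hres k w hw)
    rw [← Matrix.neg_mulVec, neg_neg] at h1
    convert h1 using 2
    ext1 i j
    rw [Matrix.mul_apply, Matrix.of_apply, Finset.sum_filter]
    refine Finset.sum_congr rfl fun l _ => ?_
    rw [Matrix.mul_diagonal]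
    split_ifs <;> simp
  have hsum : ∑ k, π k = 1 := by
    ext1 i j
    rw [Matrix.sum_apply]
    by_cases hij : i = j
    · subst hij; simp [π]
    · simp [π, hij]
  let U : Submodule ℂ (Fin m → ℂ) := ⨅ k, W.comap (X.Pc * π k).mulVecLin
  have hU : ∀ v, v ∈ U ↔ ∀ k, (X.Pc * π k).mulVec v ∈ W := fun v => by
    simp only [U, Submodule.mem_iInf, Submodule.mem_comap, Matrix.mulVecLin_apply]
  have hP : ∀ v ∈ U, X.Pc.mulVec v ∈ W := by
    intro v hv
    have h1 : X.Pc.mulVec v = ∑ k, (X.Pc * π k).mulVec v := by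
      rw [← Matrix.sum_mulVec, ← Matrix.mul_sum, hsum, Matrix.mul_one]
    rw [h1]
    exact W.sum_mem fun k _ => (hU v).1 hv k
  rcases eq_bot_or_eq_top_of_adjoin_eq_top (adjoin_eq_top h) U (by
    intro M hM v hv
    rw [hU]
    intro k
    rcases hM with rfl | hM
    · rw [Matrix.mulVec_mulVec, Θ, ← Matrix.mul_assoc, ← Matrix.mulVec_mulVec]
      exact hR k _ (hP v hv)
    · rw [Set.mem_singleton_iff] at hM
      subst hM
      have h1 : X.Pc * π k * X.S = pole k • (X.Pc * π k) := by
        ext1 i j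
        simp only [π, S, Matrix.mul_diagonal, Matrix.smul_apply, smul_eq_mul]
        split_ifs with h2
        · rw [h2, mul_comm]
        · simp
      rw [Matrix.mulVec_mulVec, h1, Matrix.smul_mulVec]
      exact W.smul_mem _ ((hU v).1 hv k)) with hbot | htop
  · left
    rw [eq_bot_iff]
    intro w hw
    have h1 : X.Qc.mulVec w ∈ U := by
      rw [hU]
      intro k
      rw [Matrix.mulVec_mulVec]
      exact hR k w hw
    rw [hbot, Submodule.mem_bot] at h1
    have h2 := congrArg X.Pc.mulVec h1
    rw [Matrix.mulVec_mulVec, Pc_mul_Qc h, Matrix.mulVec_zero] at h2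
    rw [Submodule.mem_bot]
    funext j
    have h3 := congrFun h2 j
    rw [Matrix.mulVec_diagonal] at h3
    exact (mul_eq_zero.1 h3).resolve_left
      (div_ne_zero (Int.cast_ne_zero.2 (h.Δ_ne j)) (N_ne h))
  · right
    rw [eq_top_iff]
    intro w _
    have h1 := hP (X.Qc.mulVec fun j => ((X.Δ j : ℂ) / X.N)⁻¹ * w j) (htop ▸ Submodule.mem_top)
    rw [Matrix.mulVec_mulVec, Pc_mul_Qc h] at h1
    convert h1 using 1
    funext j
    rw [Matrix.mulVec_diagonal, mul_inv_cancel_left₀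
      (div_ne_zero (Int.cast_ne_zero.2 (h.Δ_ne j)) (N_ne h))]

end Datum

lemma mults₂_of_iff {ι α α' γ γ' : Type} [Fintype ι] [DecidableEq α] [DecidableEq α']
    [DecidableEq γ] [DecidableEq γ'] (β : ι → α) (β' : ι → α') (d : ι → γ) (d' : ι → γ')
    (hβ : ∀ i j, β i = β j ↔ β' i = β' j) (hd : ∀ i j, d i = d j ↔ d' i = d' j) :
    mults₂ β d = mults₂ β' d' :=
  (levelMap_congr_fun _ _ fun s => levelMap_of_iff s d d' _ hd).trans (levelMap_of_iff _ _ _ _ hβ)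

/-! ### The Laplace transform -/

lemma transferMatrix_diagonal {m n : ℕ} (Q : Matrix (Fin m) (Fin n) ℂ) (t : Fin n → ℂ)
    (P : Matrix (Fin n) (Fin m) ℂ) :
    (Matrix.scalar (Fin n) (RatFunc.X : RatFunc ℂ) - (Matrix.diagonal t).map RatFunc.C) *
        Matrix.diagonal (fun l => (RatFunc.X - RatFunc.C (t l))⁻¹) = 1 ∧
      transferMatrix Q (Matrix.diagonal t) P =
        Matrix.of fun i j => ∑ l, RatFunc.C (Q i l * P l j) * (RatFunc.X - RatFunc.C (t l))⁻¹ := by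
  have h0 : ∀ u : ℂ, (RatFunc.X - RatFunc.C u : RatFunc ℂ) ≠ 0 := by
    intro u
    rw [← RatFunc.algebraMap_X, ← RatFunc.algebraMap_C, ← map_sub]
    exact RatFunc.algebraMap_ne_zero (Polynomial.X_sub_C_ne_zero u)
  have h1 : (Matrix.scalar (Fin n) (RatFunc.X : RatFunc ℂ) - (Matrix.diagonal t).map RatFunc.C) *
        Matrix.diagonal (fun l => (RatFunc.X - RatFunc.C (t l))⁻¹) = 1 := by
    rw [Matrix.scalar_apply, Matrix.diagonal_map (map_zero _), Matrix.diagonal_sub,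
      Matrix.diagonal_mul_diagonal, ← Matrix.diagonal_one]
    congr 1
    funext l
    exact mul_inv_cancel₀ (h0 _)
  refine ⟨h1, ?_⟩
  rw [transferMatrix, Matrix.inv_eq_right_inv h1]
  ext1 i j
  rw [Matrix.mul_apply, Matrix.of_apply]
  refine Finset.sum_congr rfl fun l _ => ?_
  rw [Matrix.mul_diagonal, Matrix.map_apply, Matrix.map_apply, map_mul]
  ring

/-- If `P Q` is invertible, then the expression `Q x⁻¹ P` is minimal, for reasons of rank. -/
lemma isMinimal_zero {m n : ℕ} (Q : Matrix (Fin m) (Fin n) ℂ) (P : Matrix (Fin n) (Fin m) ℂ)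
    (h : IsUnit (P * Q)) : IsMinimal Q (Matrix.diagonal fun _ => 0) P := by
  intro n' Q' T' P' heq
  set M : Matrix (Fin n) (Fin n) (RatFunc ℂ) := Matrix.scalar (Fin n) (RatFunc.X : RatFunc ℂ) -
    (Matrix.diagonal fun _ : Fin n => (0 : ℂ)).map RatFunc.C with hM
  set M' : Matrix (Fin n') (Fin n') (RatFunc ℂ) := Matrix.scalar (Fin n') (RatFunc.X : RatFunc ℂ) -
    T'.map RatFunc.C with hM'
  have h1 : M * Matrix.diagonal (fun _ => (RatFunc.X - RatFunc.C 0)⁻¹) = 1 :=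
    (transferMatrix_diagonal Q (fun _ => 0) P).1
  have hMu : IsUnit M⁻¹ := by
    rw [Matrix.isUnit_nonsing_inv_iff]
    exact (Matrix.isUnit_iff_isUnit_det _).2 (Matrix.isUnit_det_of_right_inverse h1)
  have hPQ : IsUnit ((P * Q).map (RatFunc.C : ℂ →+* RatFunc ℂ)) :=
    h.map (RingHom.mapMatrix (RatFunc.C : ℂ →+* RatFunc ℂ))
  have h2 : (P * Q).map (RatFunc.C : ℂ →+* RatFunc ℂ) * M⁻¹ * (P * Q).map RatFunc.C =
      (P.map RatFunc.C * Q'.map RatFunc.C) * (M'⁻¹ * (P'.map RatFunc.C * Q.map RatFunc.C)) := by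
    have h3 := congrArg (fun Z => P.map RatFunc.C * Z * Q.map RatFunc.C) heq
    simp only [transferMatrix, ← hM, ← hM'] at h3
    rw [Matrix.map_mul]
    simp only [Matrix.mul_assoc] at h3 ⊢
    exact h3.symm
  have h4 := Matrix.rank_of_isUnit _ ((hPQ.mul hMu).mul hPQ)
  rw [h2, Fintype.card_fin] at h4
  rw [← h4]
  exact (Matrix.rank_mul_le_left _ _).trans ((Matrix.rank_le_width _))

namespace Datum
variable {m r K : ℕ} {X : Datum m r K}

lemma limitCoeff_eq : X.limitCoeff =
    transferMatrix X.Qc (Matrix.diagonal fun _ => 0) X.Pc + X.S.map RatFunc.C := by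
  rw [(transferMatrix_diagonal _ _ _).2]
  ext1 i j
  rw [limitCoeff, pfrac, Matrix.add_apply, Matrix.of_apply, Matrix.of_apply, Matrix.map_apply,
    Fintype.sum_unique, Θ, Matrix.mul_apply, map_sum, Finset.sum_mul]

lemma laplaceCoeff_eq : X.laplaceCoeff =
    -transferMatrix X.Pc X.S X.Qc - (Matrix.diagonal fun _ : Fin r => (0 : ℂ)).map RatFunc.C := by
  rw [S, (transferMatrix_diagonal _ _ _).2]
  ext1 i j
  have h0 : ((Matrix.diagonal fun _ : Fin r => (0 : ℂ)).map (RatFunc.C : ℂ →+* RatFunc ℂ)) i j =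
      0 := by
    rw [Matrix.map_apply, Matrix.diagonal_zero, Matrix.zero_apply, map_zero]
  rw [laplaceCoeff, pfrac, Matrix.of_apply, Matrix.sub_apply, h0, sub_zero, Matrix.neg_apply,
    Matrix.of_apply, Matrix.zero_apply, map_zero, add_zero,
    ← Finset.sum_fiberwise Finset.univ X.β, ← Finset.sum_neg_distrib]
  refine Finset.sum_congr rfl fun k _ => ?_
  rw [Matrix.neg_apply, Matrix.of_apply, map_neg, neg_mul, map_sum, Finset.sum_mul]
  refine congrArg _ (Finset.sum_congr rfl fun l hl => ?_)
  rw [(Finset.mem_filter.1 hl).2]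

variable (h : X.Valid)
include h

lemma step_laplace : Step ⟨m, X.limitCoeff⟩ ⟨r, X.laplaceCoeff⟩ := by
  have hu : IsUnit (X.Pc * X.Qc) := by
    rw [Pc_mul_Qc h, Matrix.isUnit_diagonal, Pi.isUnit_iff]
    exact fun j => (div_ne_zero (Int.cast_ne_zero.2 (h.Δ_ne j)) (N_ne h)).isUnit
  rw [limitCoeff_eq, laplaceCoeff_eq]
  exact Step.laplace m r X.Qc _ X.Pc X.S (isMinimal_zero _ _ hu)

lemma hasLocalType_zero_limit :
    HasLocalType X.limitCoeff ((0 : ℂ) : OnePoint ℂ)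
      (regularType (mults (Sum.elim X.Δ (fun _ => 0) : Fin r ⊕ Fin (m - r) → ℤ))) := by
  obtain ⟨d, hd, hd0, hres, hm⟩ := Θ_diagonalizable h
  exact (pfrac_hasSimplePole _ _ _ (Function.injective_of_subsingleton _) ()).hasLocalType
    hd hd0 hres hm

lemma hasLocalType_infty_limit :
    HasLocalType X.limitCoeff OnePoint.infty (rankOneType (mults₂ X.β X.D)) := by
  refine hasLocalType_infty_pfrac _ _ (fun i => pole (X.β i)) (fun i => (X.D i : ℂ) / X.N) rfl
    ?_ ?_ ?_ ?_
  · obtain ⟨i, hi⟩ := h.nontrivial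
    intro h0
    have h2 := congrArg Complex.im (congrFun h0 i)
    rw [pole_im, Pi.zero_apply, Complex.zero_im] at h2
    exact hi (by exact_mod_cast h2)
  · exact fun i j hij => Θ_diagBlock h (pole_injective hij)
  · exact fun i j n hn => nonresonant h (h.D_lt i) (h.D_lt j) hn
  · refine mults₂_of_iff _ _ _ _ (fun i j => ?_) fun i j => ?_
    · rw [neg_inj, pole_injective.eq_iff]
    · rw [neg_inj, div_N_inj h]

/-- The residue `-P_k Q_k / N` has the eigenvalues `-D_i / N` of `-Q_k P_k / N`, and `0`. -/
lemma hasLocalType_pole_laplace (k : Fin K) :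
    HasLocalType X.laplaceCoeff (pole k : OnePoint ℂ) (regularType (mults
      (Sum.elim (fun i => X.D i) (fun _ => 0) :
        {i // X.β i = k} ⊕ Fin (r - Fintype.card {i // X.β i = k}) → ℤ))) := by
  let A : Matrix (Fin r) {i // X.β i = k} ℂ := Matrix.of fun a i => X.Pc a i
  let B : Matrix {i // X.β i = k} (Fin r) ℂ := Matrix.of fun i a => -X.Qc i a
  have hBA : B * A = Matrix.diagonal fun i : {i // X.β i = k} => ((-X.D i : ℤ) : ℂ) / X.N := by
    ext1 i j
    have h1 : (B * A) i j = -X.Θ i j := by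
      simp [A, B, Matrix.mul_apply, Θ]
    rw [h1, Θ_diagBlock h (i.2.trans j.2.symm)]
    by_cases hij : i = j
    · subst hij
      rw [Matrix.diagonal_apply_eq, Matrix.diagonal_apply_eq]
      push_cast
      ring
    · rw [Matrix.diagonal_apply_ne _ hij, Matrix.diagonal_apply_ne _ fun h2 => hij (Subtype.ext h2),
        neg_zero]
  have hR : A * B = -Matrix.of fun i j => ∑ l with X.β l = k, X.Pc i l * X.Qc l j := by
    ext1 i j
    rw [Matrix.mul_apply, Matrix.neg_apply, Matrix.of_apply, ← Finset.sum_neg_distrib,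
      Finset.sum_subtype _ (p := fun l => X.β l = k) (fun l => by simp)]
    refine Finset.sum_congr rfl fun l _ => ?_
    simp [A, B]
  obtain ⟨e, he⟩ := diagonalizableTo_of_mul (c := r - Fintype.card {i // X.β i = k}) A B
    (fun i => ((-X.D i : ℤ) : ℂ) / X.N)
    (fun i => div_ne_zero (Int.cast_ne_zero.2 (neg_ne_zero.2 (h.D_ne i))) (N_ne h)) hBA (by
      have := h.card_le k
      omega)
  rw [hR] at he
  let f : {i // X.β i = k} ⊕ Fin (r - Fintype.card {i // X.β i = k}) → ℤ :=
    Sum.elim (fun i => X.D i) (fun _ => 0)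
  have hf : ∀ x, (Sum.elim (fun i => ((-X.D i : ℤ) : ℂ) / X.N) 0 :
      {i // X.β i = k} ⊕ Fin (r - Fintype.card {i // X.β i = k}) → ℂ) x =
      ((-f x : ℤ) : ℂ) / X.N := by
    rintro (j | j) <;> simp [f]
  have hlt : ∀ x, 2 * |-f x| < X.N := by
    intro x
    rw [abs_neg]
    rcases x with j | j
    · exact h.D_lt j
    · have := N_pos h
      simpa [f] using this
  refine (pfrac_hasSimplePole _ _ _ pole_injective k).hasLocalType he ?_ ?_ ?_
  · obtain ⟨i, hi⟩ := h.surj k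
    intro h0
    have h1 := congrFun h0 (e (Sum.inl ⟨i, hi⟩))
    rw [Function.comp_apply, Equiv.symm_apply_apply, hf] at h1
    exact div_ne_zero (Int.cast_ne_zero.2 (neg_ne_zero.2 (h.D_ne i))) (N_ne h) h1
  · intro i j n hn
    rw [Function.comp_apply, Function.comp_apply, hf, hf] at hn
    exact nonresonant h (hlt _) (hlt _) hn
  · rw [mults_comp_equiv]
    refine mults_of_iff _ _ fun x y => ?_
    rw [hf, hf, div_N_inj h, neg_inj]

lemma hasLocalType_infty_laplace :
    HasLocalType X.laplaceCoeff OnePoint.infty (regularType (mults X.Δ)) := by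
  have hsum : (-∑ k : Fin K, -Matrix.of fun i j => ∑ l with X.β l = k, X.Pc i l * X.Qc l j) =
      Matrix.diagonal fun j => (X.Δ j : ℂ) / X.N := by
    rw [← Pc_mul_Qc h, Finset.sum_neg_distrib, neg_neg]
    ext1 i j
    rw [Matrix.sum_apply, Matrix.mul_apply, ← Finset.sum_fiberwise Finset.univ X.β]
    rfl
  have hd : DiagonalizableTo (-∑ k : Fin K, -Matrix.of fun i j =>
      ∑ l with X.β l = k, X.Pc i l * X.Qc l j) fun j => (X.Δ j : ℂ) / X.N := by
    rw [hsum]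
    exact ⟨1, by simp⟩
  refine (pfrac_hasSimplePole_infty _ _).hasLocalType hd ?_ ?_ ?_
  · intro h0
    exact div_ne_zero (Int.cast_ne_zero.2 (h.Δ_ne ⟨0, h.r_pos⟩)) (N_ne h) (congrFun h0 _)
  · exact fun i j n hn => nonresonant h (h.Δ_lt i) (h.Δ_lt j) hn
  · exact mults_of_iff _ _ fun i j => div_N_inj h

end Datum

/-! ### The arrow given by a datum -/

lemma fuchsianType_eq (L : List (List ℕ)) :
    fuchsianType L = Multiset.map regularType (L.map fun l => (l : Multiset ℕ) : List _) := by
  rw [fuchsianType, Multiset.map_coe, List.map_map]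
  rfl

lemma typeOf_cons {k : ℕ} (a : LocalType) (τ : Fin k → LocalType) :
    typeOf (Fin.cons a τ : Fin (k + 1) → LocalType) = a ::ₘ typeOf τ := by
  rw [typeOf, typeOf, Fin.univ_succ, Finset.cons_val, Multiset.map_cons, Fin.cons_zero,
    Finset.map_val, Multiset.map_map]
  rfl

lemma hasTypesAt_cons {m k : ℕ} {A : Matrix (Fin m) (Fin m) (RatFunc ℂ)} {p : OnePoint ℂ}
    {s : Fin k → OnePoint ℂ} {a : LocalType} {τ : Fin k → LocalType} (hp : p ∉ Set.range s)
    (hs : Function.Injective s) (ha : HasLocalType A p a) (hτ : ∀ i, HasLocalType A (s i) (τ i))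
    (hn : ∀ q, q ≠ p → q ∉ Set.range s → IsNonsingularAt A q) :
    HasTypesAt A (Fin.cons p s : Fin (k + 1) → OnePoint ℂ)
      (Fin.cons a τ : Fin (k + 1) → LocalType) := by
  refine ⟨Fin.cons_injective_iff.2 ⟨hp, hs⟩, fun i => ?_, fun q hq => ?_⟩
  · induction i using Fin.cases with
    | zero => exact ha
    | succ i => exact hτ i
  · rw [Fin.range_cons, Set.mem_insert_iff, not_or] at hq
    exact hn q hq.1 hq.2

namespace Datum
variable {m r K : ℕ} {X : Datum m r K} (h : X.Valid)
include h

/-- The partition of `m` by the multiplicities of the eigenvalues of `Θ`. -/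
local notation "ν" => mults (Sum.elim X.Δ (fun _ => 0) : Fin r ⊕ Fin (m - r) → ℤ)

lemma hasTypesAt_family {ε : ℝ} (hε : 0 < ε) :
    HasTypesAt (X.family ε)
      (Fin.cons (((ε : ℂ)⁻¹ : ℂ) : OnePoint ℂ)
        (Fin.cons OnePoint.infty fun _ : Fin 1 => ((0 : ℂ) : OnePoint ℂ)))
      (Fin.cons (regularType (mults X.β)) (Fin.cons (regularType (mults fun i => (X.β i, X.D i)))
        fun _ : Fin 1 => regularType ν)) := by
  have hε' : (ε : ℂ)⁻¹ ≠ 0 := inv_ne_zero (Complex.ofReal_ne_zero.2 hε.ne')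
  have h1 : Set.range (fun _ : Fin 1 => ((0 : ℂ) : OnePoint ℂ)) = {((0 : ℂ) : OnePoint ℂ)} :=
    Set.range_const
  refine hasTypesAt_cons ?_ ?_ (hasLocalType_inv_family h hε) ?_ ?_
  · rw [Fin.range_cons, h1]
    rintro (h2 | h2)
    · exact OnePoint.coe_ne_infty _ h2
    · exact hε' (OnePoint.coe_injective h2)
  · refine Fin.cons_injective_iff.2 ⟨?_, Function.injective_of_subsingleton _⟩
    rw [h1]
    exact OnePoint.infty_ne_coe _
  · intro i
    induction i using Fin.cases with
    | zero => exact hasLocalType_infty_family h hε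
    | succ i => exact hasLocalType_zero_family h hε
  · intro q hq hq'
    rw [Fin.range_cons, h1, Set.mem_insert_iff, not_or] at hq'
    exact isNonsingularAt_family hq'.2 hq hq'.1

lemma hasTypesAt_limit :
    HasTypesAt X.limitCoeff (Fin.cons OnePoint.infty fun _ : Fin 1 => ((0 : ℂ) : OnePoint ℂ))
      (Fin.cons (rankOneType (mults₂ X.β X.D)) fun _ : Fin 1 => regularType ν) := by
  have h1 : Set.range (fun _ : Fin 1 => ((0 : ℂ) : OnePoint ℂ)) = {((0 : ℂ) : OnePoint ℂ)} :=
    Set.range_const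
  refine hasTypesAt_cons ?_ (Function.injective_of_subsingleton _) (hasLocalType_infty_limit h)
    (fun _ => hasLocalType_zero_limit h) ?_
  · rw [h1]
    exact OnePoint.infty_ne_coe _
  · intro q hq hq'
    rw [h1, Set.mem_singleton_iff] at hq'
    induction q using OnePoint.rec with
    | infty => exact absurd rfl hq
    | coe q => exact pfrac_isNonsingularAt _ _ _ fun _ h2 => hq' (congrArg _ h2)

lemma hasTypesAt_laplace :
    HasTypesAt X.laplaceCoeff (Fin.cons OnePoint.infty fun k : Fin K => (pole k : OnePoint ℂ))
      (Fin.cons (regularType (mults X.Δ)) fun k : Fin K => regularType (mults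
        (Sum.elim (fun i => X.D i) (fun _ => 0) :
          {i // X.β i = k} ⊕ Fin (r - Fintype.card {i // X.β i = k}) → ℤ))) := by
  refine hasTypesAt_cons ?_ (OnePoint.coe_injective.comp pole_injective)
    (hasLocalType_infty_laplace h) (hasLocalType_pole_laplace h) ?_
  · rintro ⟨k, hk⟩
    exact OnePoint.coe_ne_infty _ hk
  · intro q hq hq'
    induction q using OnePoint.rec with
    | infty => exact absurd rfl hq
    | coe q => exact pfrac_isNonsingularAt _ _ _ fun k h2 => hq' ⟨k, congrArg _ h2.symm⟩

omit h in
lemma tendsto_evalAt_family {x : ℂ} (hx : x ≠ 0) :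
    Tendsto (fun ε : ℝ => evalAt (X.family ε) x) (𝓝[>] 0) (𝓝 (evalAt X.limitCoeff x)) := by
  have hlim : evalAt X.limitCoeff x = x⁻¹ • X.Θ + X.S := by
    rw [limitCoeff, evalAt_pfrac _ _ _ fun _ => hx]
    simp
  -- `(S / ε + L) / (x - 1 / ε) = (S + ε L) / (ε x - 1)`
  have hcont : ContinuousAt (fun ε : ℝ => x⁻¹ • X.Θ +
      (1 - (ε : ℂ) * x)⁻¹ • (X.S + (ε : ℂ) • X.L)) 0 := by
    have h1 : ContinuousAt (fun ε : ℝ => (ε : ℂ)) 0 := Complex.continuous_ofReal.continuousAt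
    refine continuousAt_const.add (ContinuousAt.smul (ContinuousAt.inv₀
      (continuousAt_const.sub (h1.mul continuousAt_const)) (by simp))
      (continuousAt_const.add (h1.smul continuousAt_const)))
  have h0 := hcont.tendsto.mono_left (nhdsWithin_le_nhds (s := Set.Ioi (0 : ℝ)))
  simp only [Complex.ofReal_zero, zero_mul, sub_zero, inv_one, one_smul, zero_smul, add_zero] at h0
  rw [hlim]
  refine h0.congr' ?_
  have hne : ∀ᶠ ε : ℝ in 𝓝[>] 0, (1 - (ε : ℂ) * x) ≠ 0 := by
    have h1 : ContinuousAt (fun ε : ℝ => (1 - (ε : ℂ) * x)) 0 :=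
      continuousAt_const.sub (Complex.continuous_ofReal.continuousAt.mul continuousAt_const)
    exact (h1.eventually_ne (y := 0) (by simp)).filter_mono nhdsWithin_le_nhds
  filter_upwards [hne, self_mem_nhdsWithin] with ε hε hpos
  have hε' : (ε : ℂ) ≠ 0 := Complex.ofReal_ne_zero.2 (ne_of_gt hpos)
  have hxε : x ≠ (ε : ℂ)⁻¹ := by
    rintro rfl
    rw [mul_inv_cancel₀ hε', sub_self] at hε
    exact hε rfl
  have hpoles : ∀ k, x ≠ (![0, (ε : ℂ)⁻¹] : Fin 2 → ℂ) k := by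
    intro k
    fin_cases k
    · exact hx
    · exact hxε
  rw [family, evalAt_pfrac _ _ _ hpoles, add_zero, Fin.sum_univ_two]
  change _ = (x - 0)⁻¹ • X.Θ + (x - (ε : ℂ)⁻¹)⁻¹ • -((ε : ℂ)⁻¹ • X.S + X.L)
  have h2 : (ε : ℂ)⁻¹ • X.S + X.L = (ε : ℂ)⁻¹ • (X.S + (ε : ℂ) • X.L) := by
    rw [smul_add, smul_smul, inv_mul_cancel₀ hε', one_smul]
  rw [sub_zero, h2, smul_neg, smul_smul, ← neg_smul]
  congr 2
  have h3 : x - (ε : ℂ)⁻¹ = -((ε : ℂ)⁻¹ * (1 - (ε : ℂ) * x)) := by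
    rw [mul_sub, mul_one, inv_mul_cancel_left₀ hε']
    ring
  rw [h3, inv_neg, mul_inv, inv_inv, neg_mul, neg_neg, mul_right_comm,
    mul_inv_cancel₀ hε', one_mul]

omit h in
lemma tendsto_inv_infty :
    Tendsto (fun ε : ℝ => (((ε : ℂ)⁻¹ : ℂ) : OnePoint ℂ)) (𝓝[>] 0) (𝓝 OnePoint.infty) := by
  refine OnePoint.tendsto_coe_infty.comp ?_
  rw [Filter.coclosedCompact_eq_cocompact, ← Metric.cobounded_eq_cocompact]
  refine Filter.tendsto_inv₀_nhdsNE_zero.comp ?_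
  refine tendsto_nhdsWithin_iff.2 ⟨?_, ?_⟩
  · have h1 := (Complex.continuous_ofReal.tendsto 0).mono_left
      (nhdsWithin_le_nhds (s := Set.Ioi (0 : ℝ)))
    rwa [Complex.ofReal_zero] at h1
  · filter_upwards [self_mem_nhdsWithin] with ε hε
    exact Complex.ofReal_ne_zero.2 (ne_of_gt hε)

/-- A valid datum gives an arrow: the system `Θ / x + S` is a confluence of the Fuchsian systems
of the family, and its Laplace transform is Fuchsian. -/
theorem arrow (L₁ L₂ : List (List ℕ))
    (hβ : mults X.β = (mults₂ X.β X.D).map Multiset.sum)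
    (hβD : (mults fun i => (X.β i, X.D i)) = (mults₂ X.β X.D).sum)
    (hL₁ : (L₁.map fun l => (l : Multiset ℕ) : Multiset (Multiset ℕ)) =
      mults X.β ::ₘ (mults fun i => (X.β i, X.D i)) ::ₘ {ν})
    (hL₂ : (L₂.map fun l => (l : Multiset ℕ) : Multiset (Multiset ℕ)) =
      mults X.Δ ::ₘ (Finset.univ.val.map fun k : Fin K => mults
        (Sum.elim (fun i => X.D i) (fun _ => 0) :
          {i // X.β i = k} ⊕ Fin (r - Fintype.card {i // X.β i = k}) → ℤ))) :
    Arrow (fuchsianType L₁) (fuchsianType L₂) := by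
  have hS₁ : fuchsianType L₁ = regularType (mults X.β) ::ₘ
      regularType (mults fun i => (X.β i, X.D i)) ::ₘ typeOf fun _ : Fin 1 => regularType ν := by
    rw [fuchsianType_eq, hL₁]
    rfl
  have hS₂ : fuchsianType L₂ = typeOf (Fin.cons (regularType (mults X.Δ)) fun k : Fin K =>
      regularType (mults (Sum.elim (fun i => X.D i) (fun _ => 0) :
        {i // X.β i = k} ⊕ Fin (r - Fintype.card {i // X.β i = k}) → ℤ))) := by
    rw [fuchsianType_eq, hL₂, typeOf_cons, Multiset.map_cons, Multiset.map_map]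
    rfl
  refine ⟨fuchsianType L₁, rankOneType (mults₂ X.β X.D) ::ₘ typeOf fun _ : Fin 1 => regularType ν,
    ?_, ?_, m, X.family, X.limitCoeff, ?_⟩
  · obtain ⟨ε, hirr, hε⟩ := ((irreducible_family h).and self_mem_nhdsWithin).exists
    have hreal : Realizes ⟨m, X.family ε⟩ (fuchsianType L₁) :=
      ⟨hirr, _, _, _, hasTypesAt_family h hε, by rw [hS₁, typeOf_cons, typeOf_cons]⟩
    exact ⟨_, _, hreal, hreal, Relation.ReflTransGen.refl⟩
  · exact ⟨⟨m, X.limitCoeff⟩, ⟨r, X.laplaceCoeff⟩,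
      ⟨irreducible_limitCoeff h, _, _, _, hasTypesAt_limit h, (typeOf_cons _ _).symm⟩,
      ⟨irreducible_laplaceCoeff h, _, _, _, hasTypesAt_laplace h, hS₂⟩,
      Relation.ReflTransGen.single (step_laplace h)⟩
  · refine ⟨1, mults₂ X.β X.D, fun _ => regularType ν, fun ε => (((ε : ℂ)⁻¹ : ℂ) : OnePoint ℂ),
      fun _ => OnePoint.infty, fun _ _ => ((0 : ℂ) : OnePoint ℂ), OnePoint.infty,
      fun _ => ((0 : ℂ) : OnePoint ℂ), ?_, rfl, ?_, irreducible_limitCoeff h, hasTypesAt_limit h,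
      tendsto_inv_infty, tendsto_const_nhds, fun _ => tendsto_const_nhds, fun x _ hx => ?_⟩
    · rw [hS₁, hβ, hβD]
    · filter_upwards [irreducible_family h, self_mem_nhdsWithin] with ε hirr hε
      refine ⟨hirr, ?_⟩
      rw [← hβ, ← hβD]
      exact hasTypesAt_family h hε
    · exact tendsto_evalAt_family fun h0 => hx 0 (congrArg _ h0)

end Datum

/-! ### The integral solutions -/

/-- Integral data for the arrow from 44,332,11111111 to 32,11111,11111. -/
def datum_44_332_to_32 : Datum 8 5 2 where
  P := !![-3, 1, -1, -21, 0, -1, 1, 1;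
          3, -1, -7, -3, -3, -1, -2, -1;
          -1, -1, -3, 45, 0, 1, 0, -3;
          -3, 1, 7, 19, 1, 3, 1, 1;
          1, 1, 3, 3, 0, 1, 0, 1]
  Q := !![-6, 0, -1, -6, 11;
          8, 4, 3, 0, 15;
          2, -4, 3, -6, 3;
          0, 0, -1, 0, -1;
          16, 16, 0, 16, -16;
          -4, 4, 4, 12, 8;
          -40, -8, -8, -24, 32;
          -4, 4, -12, 12, -24]
  N := 97
  β := ![0, 0, 0, 0, 1, 1, 1, 1]
  D := ![48, 16, -16, -48, -32, 48, -48, 16]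
  Δ := ![-16, -16, -16, 16, 16]

lemma valid_44_332_to_32 : datum_44_332_to_32.Valid where
  r_pos := by decide
  r_le := by decide
  card_le := by decide +kernel
  surj := by decide +kernel
  nontrivial := by decide +kernel
  PQ := by decide +kernel
  QP := by decide +kernel
  D_ne := by decide +kernel
  Δ_ne := by decide +kernel
  D_lt := by decide +kernel
  Δ_lt := by decide +kernel
  reaches := ⟨0, ![0, 1, 2, 3, 4, 5, 6, 7],
    ![[], [1, 4], [2, 4], [3, 5], [4], [5], [6], [7]],
    ![[], [1, 5], [2, 4], [3, 4], [4], [5], [6], [7]],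
    by decide +kernel, by decide +kernel, by decide +kernel⟩

lemma arrow_44_332_to_32 : Arrow
    (fuchsianType [[4, 4], [3, 3, 2], [1, 1, 1, 1, 1, 1, 1, 1]])
    (fuchsianType [[3, 2], [1, 1, 1, 1, 1], [1, 1, 1, 1, 1]]) :=
  datum_44_332_to_32.arrow valid_44_332_to_32 _ _ (by decide +kernel)
    (by decide +kernel) (by decide +kernel) (by decide +kernel)

/-- Integral data for the arrow from 32,11111,11111 to 211,1111,1111. -/
def datum_32_to_211 : Datum 5 4 2 where
  P := !![2, 2, -3, 2, 0;
          -1, -3, 2, -1, -1;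
          1, -1, 0, -1, -3;
          0, 2, 0, 1, 3]
  Q := !![2, 3, 1, 3;
          -2, -3, 1, 1;
          0, 2, 2, 4;
          4, 3, 1, 2;
          0, 1, -1, 0]
  N := 17
  β := ![0, 0, 0, 1, 1]
  D := ![2, 6, 4, 6, 2]
  Δ := ![8, 6, 2, 4]

lemma valid_32_to_211 : datum_32_to_211.Valid where
  r_pos := by decide
  r_le := by decide
  card_le := by decide +kernel
  surj := by decide +kernel
  nontrivial := by decide +kernel
  PQ := by decide +kernel
  QP := by decide +kernel
  D_ne := by decide +kernel
  Δ_ne := by decide +kernel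
  D_lt := by decide +kernel
  Δ_lt := by decide +kernel
  reaches := ⟨4, ![0, 1, 2, 3, 4],
    ![[0], [1], [2], [3, 0], []],
    ![[0], [1], [2], [3, 0], []],
    by decide +kernel, by decide +kernel, by decide +kernel⟩

lemma arrow_32_to_211 : Arrow
    (fuchsianType [[3, 2], [1, 1, 1, 1, 1], [1, 1, 1, 1, 1]])
    (fuchsianType [[2, 1, 1], [1, 1, 1, 1], [1, 1, 1, 1]]) :=
  datum_32_to_211.arrow valid_32_to_211 _ _ (by decide +kernel)
    (by decide +kernel) (by decide +kernel) (by decide +kernel)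

/-- Integral data for the arrow from 33,2211,111111 to 211,1111,1111. -/
def datum_33_2211_to_211 : Datum 6 4 2 where
  P := !![-3, 1, -5, 1, -2, -1;
          1, -1, 3, -1, 0, 1;
          -1, 1, 1, 0, 1, 1;
          2, 2, 0, 1, 1, 0]
  Q := !![0, -1, 3, -2;
          -1, -1, -2, -2;
          0, -1, -1, 0;
          -1, -1, 0, -2;
          3, 5, -2, 2;
          -2, -4, -2, -2]
  N := 21
  β := ![0, 0, 0, 1, 1, 1]
  D := ![-8, -6, -4, -2, -6, -4]
  Δ := ![-6, -6, -10, -8]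

lemma valid_33_2211_to_211 : datum_33_2211_to_211.Valid where
  r_pos := by decide
  r_le := by decide
  card_le := by decide +kernel
  surj := by decide +kernel
  nontrivial := by decide +kernel
  PQ := by decide +kernel
  QP := by decide +kernel
  D_ne := by decide +kernel
  Δ_ne := by decide +kernel
  D_lt := by decide +kernel
  Δ_lt := by decide +kernel
  reaches := ⟨2, ![0, 1, 2, 3, 4, 5],
    ![[0, 3], [1, 3], [], [3], [4], [5]],
    ![[0, 3], [1, 3], [], [3], [4], [5]],
    by decide +kernel, by decide +kernel, by decide +kernel⟩

lemma arrow_33_2211_to_211 : Arrow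
    (fuchsianType [[3, 3], [2, 2, 1, 1], [1, 1, 1, 1, 1, 1]])
    (fuchsianType [[2, 1, 1], [1, 1, 1, 1], [1, 1, 1, 1]]) :=
  datum_33_2211_to_211.arrow valid_33_2211_to_211 _ _ (by decide +kernel)
    (by decide +kernel) (by decide +kernel) (by decide +kernel)

/-- Integral data for the arrow from 33,2211,111111 to 221,221,11111. -/
def datum_33_2211_to_221 : Datum 6 5 2 where
  P := !![5, 2, -15, -5, -1, 35;
          -6, -3, 101, 4, 1, -74;
          1, 0, -1, 1, 0, -1;
          0, 0, -20, 0, -1, -10;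
          0, 1, 15, 0, 1, 10]
  Q := !![-1, -1, -81, -1, -1;
          5, 5, 5, -35, -75;
          1, 1, 1, 1, 1;
          3, 2, -33, 5, 6;
          -30, -20, -70, -10, -60;
          1, 0, 5, 3, 4]
  N := 241
  β := ![0, 0, 0, 1, 1, 1]
  D := ![-80, -80, 80, -40, -40, 40]
  Δ := ![40, 80, -120, -40, -80]

lemma valid_33_2211_to_221 : datum_33_2211_to_221.Valid where
  r_pos := by decide
  r_le := by decide
  card_le := by decide +kernel
  surj := by decide +kernel
  nontrivial := by decide +kernel
  PQ := by decide +kernel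
  QP := by decide +kernel
  D_ne := by decide +kernel
  Δ_ne := by decide +kernel
  D_lt := by decide +kernel
  Δ_lt := by decide +kernel
  reaches := ⟨5, ![1, 0, 2, 4, 3, 5],
    ![[0], [1, 3, 0], [2], [3, 0], [4, 2], []],
    ![[0], [1, 3, 0], [2], [3, 0], [4, 1, 3, 0], []],
    by decide +kernel, by decide +kernel, by decide +kernel⟩

lemma arrow_33_2211_to_221 : Arrow
    (fuchsianType [[3, 3], [2, 2, 1, 1], [1, 1, 1, 1, 1, 1]])
    (fuchsianType [[2, 2, 1], [2, 2, 1], [1, 1, 1, 1, 1]]) :=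
  datum_33_2211_to_221.arrow valid_33_2211_to_221 _ _ (by decide +kernel)
    (by decide +kernel) (by decide +kernel) (by decide +kernel)

/-- Integral data for the arrow from 211,1111,1111 to 11,11,11,11,11. -/
def datum_211_to_11 : Datum 4 2 4 where
  P := !![0, 2, 1, -2;
          -1, 0, 2, -2]
  Q := !![2, -2;
          -1, -1;
          1, 0;
          0, -1]
  N := 9
  β := ![0, 1, 2, 3]
  D := ![2, -2, 1, 2]
  Δ := ![-1, 4]

lemma valid_211_to_11 : datum_211_to_11.Valid where
  r_pos := by decide
  r_le := by decide
  card_le := by decide +kernel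
  surj := by decide +kernel
  nontrivial := by decide +kernel
  PQ := by decide +kernel
  QP := by decide +kernel
  D_ne := by decide +kernel
  Δ_ne := by decide +kernel
  D_lt := by decide +kernel
  Δ_lt := by decide +kernel
  reaches := ⟨1, ![0, 1, 2, 3],
    ![[0], [], [2], [3, 0]],
    ![[0], [], [2], [3]],
    by decide +kernel, by decide +kernel, by decide +kernel⟩

lemma arrow_211_to_11 : Arrow
    (fuchsianType [[2, 1, 1], [1, 1, 1, 1], [1, 1, 1, 1]])
    (fuchsianType [[1, 1], [1, 1], [1, 1], [1, 1], [1, 1]]) :=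
  datum_211_to_11.arrow valid_211_to_11 _ _ (by decide +kernel)
    (by decide +kernel) (by decide +kernel) (by decide +kernel)

/-- Integral data for the arrow from 211,1111,1111 to 21,21,111,111. -/
def datum_211_to_21_21 : Datum 4 3 3 where
  P := !![2, 1, 0, 1;
          -3, -1, 1, -1;
          1, 2, 1, 1]
  Q := !![1, 1, 0;
          4, 3, 1;
          -1, -2, 0;
          -8, -5, -1]
  N := 9
  β := ![0, 0, 1, 2]
  D := ![-1, 3, -2, -4]
  Δ := ![-2, -3, 1]

lemma valid_211_to_21_21 : datum_211_to_21_21.Valid where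
  r_pos := by decide
  r_le := by decide
  card_le := by decide +kernel
  surj := by decide +kernel
  nontrivial := by decide +kernel
  PQ := by decide +kernel
  QP := by decide +kernel
  D_ne := by decide +kernel
  Δ_ne := by decide +kernel
  D_lt := by decide +kernel
  Δ_lt := by decide +kernel
  reaches := ⟨2, ![0, 1, 2, 3],
    ![[0], [1], [], [3]],
    ![[0], [1], [], [3]],
    by decide +kernel, by decide +kernel, by decide +kernel⟩

lemma arrow_211_to_21_21 : Arrow
    (fuchsianType [[2, 1, 1], [1, 1, 1, 1], [1, 1, 1, 1]])
    (fuchsianType [[2, 1], [2, 1], [1, 1, 1], [1, 1, 1]]) :=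
  datum_211_to_21_21.arrow valid_211_to_21_21 _ _ (by decide +kernel)
    (by decide +kernel) (by decide +kernel) (by decide +kernel)

/-- Integral data for the arrow from 221,221,11111 to 21,21,111,111. -/
def datum_221_to_21_21 : Datum 5 3 3 where
  P := !![1, -1, -1, 0, -1;
          0, -2, -1, -1, -1;
          3, 1, 2, 3, 1]
  Q := !![1, 0, 1;
          0, 1, 0;
          1, 0, 0;
          -2, 0, -1;
          1, -1, 1]
  N := 9
  β := ![0, 0, 1, 1, 2]
  D := ![4, -2, -1, -3, 1]
  Δ := ![-1, -1, 1]

lemma valid_221_to_21_21 : datum_221_to_21_21.Valid where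
  r_pos := by decide
  r_le := by decide
  card_le := by decide +kernel
  surj := by decide +kernel
  nontrivial := by decide +kernel
  PQ := by decide +kernel
  QP := by decide +kernel
  D_ne := by decide +kernel
  Δ_ne := by decide +kernel
  D_lt := by decide +kernel
  Δ_lt := by decide +kernel
  reaches := ⟨4, ![0, 1, 2, 3, 4],
    ![[0, 2], [1], [2], [3], []],
    ![[0], [1], [2], [3], []],
    by decide +kernel, by decide +kernel, by decide +kernel⟩

lemma arrow_221_to_21_21 : Arrow
    (fuchsianType [[2, 2, 1], [2, 2, 1], [1, 1, 1, 1, 1]])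
    (fuchsianType [[2, 1], [2, 1], [1, 1, 1], [1, 1, 1]]) :=
  datum_221_to_21_21.arrow valid_221_to_21_21 _ _ (by decide +kernel)
    (by decide +kernel) (by decide +kernel) (by decide +kernel)

/-- Integral data for the arrow from 221,221,11111 to 31,22,22,1111. -/
def datum_221_to_31_22 : Datum 5 4 3 where
  P := !![0, 3, 1, 1, 3;
          1, 0, 1, 0, 1;
          0, -4, 0, -1, -2;
          0, 6, 0, 1, 2]
  Q := !![6, 2, 6, 1;
          0, 0, -2, -1;
          -1, -5, 34, 35;
          10, -10, 92, 76;
          -5, 5, -40, -36]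
  N := 13
  β := ![0, 0, 1, 1, 2]
  D := ![2, 2, -6, -6, -2]
  Δ := ![-6, 2, -4, -2]

lemma valid_221_to_31_22 : datum_221_to_31_22.Valid where
  r_pos := by decide
  r_le := by decide
  card_le := by decide +kernel
  surj := by decide +kernel
  nontrivial := by decide +kernel
  PQ := by decide +kernel
  QP := by decide +kernel
  D_ne := by decide +kernel
  Δ_ne := by decide +kernel
  D_lt := by decide +kernel
  Δ_lt := by decide +kernel
  reaches := ⟨4, ![1, 0, 3, 2, 4],
    ![[0], [1, 3, 0], [2], [3, 0], []],
    ![[0], [1, 2], [2], [3, 0], []],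
    by decide +kernel, by decide +kernel, by decide +kernel⟩

lemma arrow_221_to_31_22 : Arrow
    (fuchsianType [[2, 2, 1], [2, 2, 1], [1, 1, 1, 1, 1]])
    (fuchsianType [[3, 1], [2, 2], [2, 2], [1, 1, 1, 1]]) :=
  datum_221_to_31_22.arrow valid_221_to_31_22 _ _ (by decide +kernel)
    (by decide +kernel) (by decide +kernel) (by decide +kernel)

/-- Integral data for the arrow from 66,444,2222211 to 44,2222,22211. -/
def datum_66_444_to_44_2222 : Datum 12 8 2 where
  P := !![0, 2, -1, 1, -43, 1, -1, 0, 12, -7, -1, 0;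
          -1, 0, -385, -23, 421, -7, 0, -116, -272, 105, 23, 1;
          0, 1, -9, 0, -3, 0, -1, -9, -3, 1, 0, 0;
          0, -11, 0, -3, 0, -3, 0, 29, -37, 0, 3, 0;
          0, -2, 1, -1, -12, 0, 1, 12, 0, -4, 0, 0;
          1, 0, 385, 23, 88, -4, 0, 0, 140, 0, -12, -1;
          0, -2, 18, 0, 6, 0, 1, 0, 0, 2, 0, 0;
          0, 22, 0, 6, 0, 6, 0, 0, 0, 0, 6, 1]
  Q := !![-10920, -1056, 21576, 2472, -6432, -864, 6432, 1248;
          420, 48, -1044, -132, 528, 48, -528, -48;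
          81, 9, -130, -18, 99, 9, -50, -6;
          -783, -99, 1418, 234, -1377, -99, 742, 66;
          11, 1, 44, 4, 11, 1, 22, 2;
          509, 55, 2036, 220, 509, 55, 1018, 110;
          -420, -48, 1044, 132, 0, 0, 528, 48;
          0, 0, -264, -24, -132, -12, -132, -12;
          -18, 0, 234, 18, 132, 12, 84, 12;
          -132, -12, -528, -48, -396, -36, -264, -24;
          1044, 132, 5064, 456, 3972, 396, 2136, 264;
          -13860, -1584, -28140, -2556, -30240, -3168, -11760, -1296]
  N := 577
  β := ![0, 0, 0, 0, 0, 0, 1, 1, 1, 1, 1, 1]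
  D := ![192, 192, 288, 288, -96, -96, -96, 96, 96, 192, 192, 288]
  Δ := ![96, 96, 96, 96, 288, 288, 288, 288]

lemma valid_66_444_to_44_2222 : datum_66_444_to_44_2222.Valid where
  r_pos := by decide
  r_le := by decide
  card_le := by decide +kernel
  surj := by decide +kernel
  nontrivial := by decide +kernel
  PQ := by decide +kernel
  QP := by decide +kernel
  D_ne := by decide +kernel
  Δ_ne := by decide +kernel
  D_lt := by decide +kernel
  Δ_lt := by decide +kernel
  reaches := ⟨6, ![1, 0, 3, 2, 5, 4, 6, 8, 7, 10, 9, 11],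
    ![[0], [1, 7, 0], [2], [3, 7, 0], [4], [5, 7, 0], [], [7, 0], [8, 2], [9, 0], [10, 2], [11,
      0]],
    ![[0], [1, 7, 0], [2], [3, 7, 0], [4], [5, 7, 0], [], [7, 0], [8, 1, 7, 0], [9, 0], [10, 2],
      [11, 0]],
    by decide +kernel, by decide +kernel, by decide +kernel⟩

lemma arrow_66_444_to_44_2222 : Arrow
    (fuchsianType [[6, 6], [4, 4, 4], [2, 2, 2, 2, 2, 1, 1]])
    (fuchsianType [[4, 4], [2, 2, 2, 2], [2, 2, 2, 1, 1]]) :=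
  datum_66_444_to_44_2222.arrow valid_66_444_to_44_2222 _ _ (by decide +kernel)
    (by decide +kernel) (by decide +kernel) (by decide +kernel)

/-- Integral data for the arrow from 44,2222,22211 to 222,222,2211. -/
def datum_44_2222_to_222 : Datum 8 6 2 where
  P := !![-1, 0, 3, -9, -1, 0, -21, -3;
          -8, 1, 0, -1, 0, -3, -2, -1;
          -1, 0, -2, 3, 1, 0, -3, -3;
          12, -2, 0, -5, 0, 10, -20, -10;
          4, 0, 3, 0, 0, 0, 168, 6;
          0, 1, 0, 13, 0, 1, 310, 11]
  Q := !![252, 0, -252, 144, -420, 288;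
          1872, 30, -1872, 1060, -3120, 2138;
          -672, 288, 0, -96, 696, -480;
          -288, 120, 0, -40, 288, -200;
          33, 27, -63, 9, 21, -9;
          18, 0, 18, -10, -6, 4;
          3, -3, 3, -1, -1, 1;
          84, -60, 84, -20, -28, 20]
  N := 385
  β := ![0, 0, 0, 0, 1, 1, 1, 1]
  D := ![48, 48, 72, 72, -96, -96, 96, -192]
  Δ := ![-24, -24, -72, -72, 72, 72]

lemma valid_44_2222_to_222 : datum_44_2222_to_222.Valid where
  r_pos := by decide
  r_le := by decide
  card_le := by decide +kernel
  surj := by decide +kernel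
  nontrivial := by decide +kernel
  PQ := by decide +kernel
  QP := by decide +kernel
  D_ne := by decide +kernel
  Δ_ne := by decide +kernel
  D_lt := by decide +kernel
  Δ_lt := by decide +kernel
  reaches := ⟨6, ![1, 0, 3, 2, 5, 4, 6, 7],
    ![[0], [1, 4, 0], [2], [3, 4, 0], [4, 0], [5, 2], [], [7, 0]],
    ![[0], [1, 4, 0], [2], [3, 4, 0], [4, 0], [5, 2], [], [7, 0]],
    by decide +kernel, by decide +kernel, by decide +kernel⟩

lemma arrow_44_2222_to_222 : Arrow
    (fuchsianType [[4, 4], [2, 2, 2, 2], [2, 2, 2, 1, 1]])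
    (fuchsianType [[2, 2, 2], [2, 2, 2], [2, 2, 1, 1]]) :=
  datum_44_2222_to_222.arrow valid_44_2222_to_222 _ _ (by decide +kernel)
    (by decide +kernel) (by decide +kernel) (by decide +kernel)

/-- Integral data for the arrow from 222,222,2211 to 22,22,22,211. -/
def datum_222_to_22_22 : Datum 6 4 3 where
  P := !![-1, 0, -1, 0, 1, 0;
          0, 1, -1, 1, 1, 0;
          3, 0, 5, 0, -11, 1;
          0, 2, 0, 1, 4, 1]
  Q := !![30, 0, 5, 0;
          0, -5, 0, -5;
          -26, 1, -4, -1;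
          -25, 0, -5, 5;
          -1, 1, 1, -1;
          29, 6, 1, -6]
  N := 31
  β := ![0, 0, 1, 1, 2, 2]
  D := ![-15, -15, 5, 5, -15, -5]
  Δ := ![-5, -5, -15, -15]

lemma valid_222_to_22_22 : datum_222_to_22_22.Valid where
  r_pos := by decide
  r_le := by decide
  card_le := by decide +kernel
  surj := by decide +kernel
  nontrivial := by decide +kernel
  PQ := by decide +kernel
  QP := by decide +kernel
  D_ne := by decide +kernel
  Δ_ne := by decide +kernel
  D_lt := by decide +kernel
  Δ_lt := by decide +kernel
  reaches := ⟨4, ![1, 0, 3, 2, 4, 5],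
    ![[0], [1, 2], [2], [3, 0], [], [5, 0]],
    ![[0], [1, 2], [2], [3, 0], [], [5, 0]],
    by decide +kernel, by decide +kernel, by decide +kernel⟩

lemma arrow_222_to_22_22 : Arrow
    (fuchsianType [[2, 2, 2], [2, 2, 2], [2, 2, 1, 1]])
    (fuchsianType [[2, 2], [2, 2], [2, 2], [2, 1, 1]]) :=
  datum_222_to_22_22.arrow valid_222_to_22_22 _ _ (by decide +kernel)
    (by decide +kernel) (by decide +kernel) (by decide +kernel)

end DegScheme

open DegScheme in
theorem mainTheorem1 :
    -- the nine vertices with three singular points, and the four others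
    (∀ L ∈ ([[[2,1,1], [1,1,1,1], [1,1,1,1]],
             [[2,2,1], [2,2,1], [1,1,1,1,1]],
             [[3,2], [1,1,1,1,1], [1,1,1,1,1]],
             [[2,2,2], [2,2,2], [2,2,1,1]],
             [[3,3], [2,2,1,1], [1,1,1,1,1,1]],
             [[4,4], [2,2,2,2], [2,2,2,1,1]],
             [[4,4], [3,3,2], [1,1,1,1,1,1,1,1]],
             [[5,5], [3,3,3,1], [2,2,2,2,2]],
             [[6,6], [4,4,4], [2,2,2,2,2,1,1]]] : List (List (List ℕ))),
      L.length = 3 ∧ HasFourAccessoryParameters L) ∧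
    (∀ L ∈ ([[[1,1], [1,1], [1,1], [1,1], [1,1]],
             [[2,1], [2,1], [1,1,1], [1,1,1]],
             [[3,1], [2,2], [2,2], [1,1,1,1]],
             [[2,2], [2,2], [2,2], [2,1,1]]] : List (List (List ℕ))),
      HasFourAccessoryParameters L) ∧
    -- the arrows
    Arrow (fuchsianType [[4,4], [3,3,2], [1,1,1,1,1,1,1,1]])
      (fuchsianType [[3,2], [1,1,1,1,1], [1,1,1,1,1]]) ∧
    Arrow (fuchsianType [[3,2], [1,1,1,1,1], [1,1,1,1,1]])
      (fuchsianType [[2,1,1], [1,1,1,1], [1,1,1,1]]) ∧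
    Arrow (fuchsianType [[3,3], [2,2,1,1], [1,1,1,1,1,1]])
      (fuchsianType [[2,1,1], [1,1,1,1], [1,1,1,1]]) ∧
    Arrow (fuchsianType [[3,3], [2,2,1,1], [1,1,1,1,1,1]])
      (fuchsianType [[2,2,1], [2,2,1], [1,1,1,1,1]]) ∧
    Arrow (fuchsianType [[2,1,1], [1,1,1,1], [1,1,1,1]])
      (fuchsianType [[1,1], [1,1], [1,1], [1,1], [1,1]]) ∧
    Arrow (fuchsianType [[2,1,1], [1,1,1,1], [1,1,1,1]])
      (fuchsianType [[2,1], [2,1], [1,1,1], [1,1,1]]) ∧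
    Arrow (fuchsianType [[2,2,1], [2,2,1], [1,1,1,1,1]])
      (fuchsianType [[2,1], [2,1], [1,1,1], [1,1,1]]) ∧
    Arrow (fuchsianType [[2,2,1], [2,2,1], [1,1,1,1,1]])
      (fuchsianType [[3,1], [2,2], [2,2], [1,1,1,1]]) ∧
    Arrow (fuchsianType [[6,6], [4,4,4], [2,2,2,2,2,1,1]])
      (fuchsianType [[4,4], [2,2,2,2], [2,2,2,1,1]]) ∧
    Arrow (fuchsianType [[4,4], [2,2,2,2], [2,2,2,1,1]])
      (fuchsianType [[2,2,2], [2,2,2], [2,2,1,1]]) ∧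
    Arrow (fuchsianType [[2,2,2], [2,2,2], [2,2,1,1]])
      (fuchsianType [[2,2], [2,2], [2,2], [2,1,1]]) := by
  refine ⟨?_, ?_, arrow_44_332_to_32, arrow_32_to_211, arrow_33_2211_to_211, arrow_33_2211_to_221,
    arrow_211_to_11, arrow_211_to_21_21, arrow_221_to_21_21, arrow_221_to_31_22,
    arrow_66_444_to_44_2222, arrow_44_2222_to_222, arrow_222_to_22_22⟩
  · simp only [List.forall_mem_cons, List.not_mem_nil, false_implies, implies_true, and_true]
    exact ⟨⟨rfl, 4, by decide⟩, ⟨rfl, 5, by decide⟩, ⟨rfl, 5, by decide⟩, ⟨rfl, 6, by decide⟩,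
      ⟨rfl, 6, by decide⟩, ⟨rfl, 8, by decide⟩, ⟨rfl, 8, by decide⟩, ⟨rfl, 10, by decide⟩,
      ⟨rfl, 12, by decide⟩⟩
  · simp only [List.forall_mem_cons, List.not_mem_nil, false_implies, implies_true, and_true]
    exact ⟨⟨2, by decide⟩, ⟨3, by decide⟩, ⟨4, by decide⟩, ⟨4, by decide⟩⟩
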